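/- Let $1\le m\le n$ and $k\ge 2$ be integers, let $p>\frac n2$ with $p\ge 1$, and let $\sigma>0$, $T>0$. On the torus $\mathbb T^n=[0,2\pi]^n$ write $u=\sum_{j\in\mathbb Z^n}u_je^{ij\cdot x}$, let $|j|$ be the Euclidean norm, $j'=(j_1,\dots,j_m)$, $A=\sqrt{I-\Delta}$, and let $\mathscr A$ be the operator with Fourier symbol $|j'|$. Put $\|u\|_{H^s}^2=\sum_j|u_j|^2(1+|j|^2)^s$ for $s\in\mathbb R$, $\|\hat u\|_{\ell^1}=\sum_j|u_j|$, and for $\tau\in\mathbb R$ let $\mathcal D(A^pe^{\tau\mathscr A})$ be the set of $u\in L^2(\mathbb T^n)$ with $\|A^pe^{\tau\mathscr A}u\|^2=\sum_j|u_j|^2(1+|j|^2)^pe^{2\tau|j'|}<\infty$. Let $u_0\in\mathcal D(A^{p+1}e^{\sigma\mathscr A})$ and $u_1\in\mathcal D(A^pe^{\sigma\mathscr A})$, and let $u$ (complex valued, in particular possibly real valued) be a solution on $[0,T]$ of the Klein–Gordon problem $$u_{tt}-\Delta u+u\pm u^k=0,\qquad u(0)=u_0,\quad u_t(0)=u_1$$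 (with either sign), in the following sense: $u\in C([0,T];H^p)$, $u_t\in C([0,T];H^{p-1})$, $u_{tt}\in C([0,T];H^{p-2})$, and $$\langle u_{tt},\phi\rangle+(Au,A\phi)\pm\langle u^k,\phi\rangle=0\qquad\text{for all }\phi\in H^1,\ t\in[0,T].$$ Set $C_0=2^p\big(2\sum_{j\in\mathbb Z^n}(1+|j|^2)^{-p}\big)^{1/2}$, $Y_0=\big(\|A^pe^{\sigma\mathscr A}u_1\|^2+\|A^{p+1}e^{\sigma\mathscr A}u_0\|^2\big)^{1/2}$, and $$h_2(t)=\Big(C_0Y_0+\tfrac12C_0^k(e\sqrt2)^k\int_0^t\|u(s)\|_{H^p}^k\,ds\Big)^{k-1}.$$ (i) If $\tau$ satisfies $\tau'(t)=-\tau^{k+1}(t)h_2(t)$ on $[0,T]$ and $\tau(0)=\sigma$, then $u(t)\in\mathcal D(A^{p+1}e^{\tau(t)\mathscr A})$ and $u_t(t)\in\mathcal D(A^pe^{\tau(t)\mathscr A})$ for all $t\in[0,T]$. (ii) Let $y(0)=\sum_{j}e^{\sigma|j'|}\big(|(u_1)_j|^2+(1+|j|^2)|(u_0)_j|^2\big)^{1/2}$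 and $$h_1(t)=\Big(2y(0)+2^ke^k\int_0^t\|\hat u(s)\|_{\ell^1}^k\,ds\Big)^{k-1}.$$ This is the rate in the corresponding estimate based on the Wiener algebra, whose lower bound for the radius of analyticity solves $\tau'=-\tau^{k+1}h_1$, $\tau(0)=\sigma$. Then $\sum_je^{\sigma|j'|}(1+|j|^2)^{1/2}|(u_0)_j|<\infty$, $\sum_je^{\sigma|j'|}|(u_1)_j|<\infty$, $y(0)<\infty$, $\|\hat u(t)\|_{\ell^1}<\infty$ for $t\in[0,T]$, and $\|\hat u(\cdot)\|_{\ell^1}^k$ is integrable on $[0,T]$; moreover $h_1(t)\le h_2(t)$ for all $t\in[0,T]$. Consequently, if $\tau_i'=-\tau_i^{k+1}h_i$ on $[0,T]$ and $\tau_i(0)=\sigma$ for $i=1,2$, then $\tau_2(t)\le\tau_1(t)$ for all $t\in[0,T]$: the $\ell^1$ lower bound on the radius is at least as good as the $L^2$ one. -/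

import Mathlib

open MeasureTheory Filter Topology

noncomputable section

namespace KleinGordon

/-- The normalised Haar (probability) measure on the torus. The point `x ∈ [0,2π]^n` of the
physical torus is written `x = 2π y` with `y ∈ UnitAddTorus (Fin n) = (ℝ/ℤ)^n`, so that
`UnitAddTorus.mFourier j y = e^{2πi j·y} = e^{i j·x}`, and the integral against this measure is
`(2π)^{-n} ∫_{[0,2π]^n} dx`. -/
def torusMeasure (n : ℕ) : Measure (UnitAddTorus (Fin n)) :=
  Measure.pi fun _ => AddCircle.haarAddCircle

/-- The complex space `L²(𝕋ⁿ)`. -/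
abbrev L2T (n : ℕ) : Type := Lp ℂ 2 (torusMeasure n)

/-- The Fourier coefficients `u_j = (2π)^{-n} ∫ u(x) e^{-i j·x} dx` of `u ∈ L²(𝕋ⁿ)`. -/
def coeff {n : ℕ} (f : L2T n) (j : Fin n → ℤ) : ℂ :=
  UnitAddTorus.mFourierCoeff (f : UnitAddTorus (Fin n) → ℂ) j

/-- `1 + |j|²`, the symbol of `A² = I - Δ`. -/
def symb {n : ℕ} (j : Fin n → ℤ) : ℝ := 1 + ∑ i, (j i : ℝ) ^ 2

/-- `|j'|`, the Euclidean length of the first `m` components of `j`; the symbol of `𝒜`. -/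
def absFirst {n : ℕ} (m : ℕ) (j : Fin n → ℤ) : ℝ :=
  √(∑ i with i.val < m, (j i : ℝ) ^ 2)

/-! ### Sobolev spaces
For real `s` (possibly negative) an element of `H^s(𝕋ⁿ)` is represented by the family of its
Fourier coefficients. -/

/-- Membership in `H^s(𝕋ⁿ)`. -/
def MemH {n : ℕ} (s : ℝ) (c : (Fin n → ℤ) → ℂ) : Prop :=
  Summable fun j => symb j ^ s * ‖c j‖ ^ 2

/-- The norm of `H^s(𝕋ⁿ)`. -/
def normH {n : ℕ} (s : ℝ) (c : (Fin n → ℤ) → ℂ) : ℝ :=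
  √(∑' j, symb j ^ s * ‖c j‖ ^ 2)

/-- `c ∈ C([0,T]; H^s)`. -/
def ContinuousInH {n : ℕ} (T s : ℝ) (c : ℝ → (Fin n → ℤ) → ℂ) : Prop :=
  ∀ t ∈ Set.Icc 0 T, MemH s (c t) ∧
    Tendsto (fun r => normH s (c r - c t)) (𝓝[Set.Icc 0 T] t) (𝓝 0)

/-- `c'` is the time derivative of `c` on `[0,T]` in the norm of `H^s`
(one-sided at the end points). -/
def HasTimeDerivInH {n : ℕ} (T s : ℝ) (c c' : ℝ → (Fin n → ℤ) → ℂ) : Prop :=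
  ∀ t ∈ Set.Icc 0 T,
    Tendsto (fun r => normH s ((r - t)⁻¹ • (c r - c t) - c' t)) (𝓝[Set.Icc 0 T \ {t}] t) (𝓝 0)

/-- The operator `A = (I - Δ)^{1/2}` on Fourier coefficients. -/
def opA {n : ℕ} (c : (Fin n → ℤ) → ℂ) : (Fin n → ℤ) → ℂ := fun j => (√(symb j) : ℂ) * c j

/-- The pairing `∑ⱼ cⱼ conj(dⱼ)`: the `L²` inner product if both arguments are in `L²`, and the
duality pairing of `(H^1)' = H^{-1}` and `H^1` otherwise. -/
def pairing {n : ℕ} (c d : (Fin n → ℤ) → ℂ) : ℂ := ∑' j, c j * (starRingEnd ℂ) (d j)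

/-- `u`, with time derivative `v = u_t`, is a solution on `[0,T]` of
`u_tt - Δu + u + ε u^k = 0`, `u(0) = u₀`, `u_t(0) = u₁` on the torus:
`u ∈ C([0,T];H^p)`, `u_t ∈ C([0,T];H^{p-1})`, `u_tt ∈ C([0,T];H^{p-2})` and
`⟨u_tt,φ⟩ + (Au,Aφ) + ε ⟨u^k,φ⟩ = 0` for all `φ ∈ H^1` and `t ∈ [0,T]`. -/
structure IsSolution {n : ℕ} (k : ℕ) (ε T p : ℝ) (u₀ u₁ : L2T n) (u v : ℝ → L2T n) : Prop where
  init_u : u 0 = u₀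
  init_v : v 0 = u₁
  cont_u : ContinuousInH T p fun t => coeff (u t)
  cont_v : ContinuousInH T (p - 1) fun t => coeff (v t)
  deriv_u : HasTimeDerivInH T (p - 1) (fun t => coeff (u t)) (fun t => coeff (v t))
  weak_eq : ∃ w : ℝ → (Fin n → ℤ) → ℂ, ContinuousInH T (p - 2) w ∧
    HasTimeDerivInH T (p - 2) (fun t => coeff (v t)) w ∧
    ∀ t ∈ Set.Icc 0 T, ∀ φ : L2T n, MemH 1 (coeff φ) →
      pairing (w t) (coeff φ) + pairing (opA (coeff (u t))) (opA (coeff φ))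
        + (ε : ℂ) * ∫ x, u t x ^ k * (starRingEnd ℂ) (φ x) ∂(torusMeasure n) = 0

/-! ### Gevrey classes -/

/-- The domain `𝒟(A^p e^{τ𝒜}) ⊆ L²(𝕋ⁿ)`. -/
def gevreyDomain (n m : ℕ) (p τ : ℝ) : Set (L2T n) :=
  {f | Summable fun j => ‖coeff f j‖ ^ 2 * symb j ^ p * Real.exp (2 * τ * absFirst m j)}

/-- The norm `‖A^p e^{τ𝒜} f‖`. -/
def gevreyNorm {n : ℕ} (m : ℕ) (p τ : ℝ) (f : L2T n) : ℝ :=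
  √(∑' j, ‖coeff f j‖ ^ 2 * symb j ^ p * Real.exp (2 * τ * absFirst m j))

/-- Membership in the Gevrey class `G_τ(ℓ¹)` based on the Wiener algebra. -/
def MemGevreyL1 {n : ℕ} (m : ℕ) (τ : ℝ) (c : (Fin n → ℤ) → ℂ) : Prop :=
  Summable fun j => Real.exp (τ * absFirst m j) * ‖c j‖

/-- The norm `‖û‖_{ℓ¹}` of the Wiener algebra. -/
def wienerNorm {n : ℕ} (c : (Fin n → ℤ) → ℂ) : ℝ := ∑' j, ‖c j‖

/-! ### The two rate functions -/

/-- `C₀ = 2^p (2 ∑ⱼ (1+|j|²)^{-p})^{1/2}`. -/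
def constC₀ (n : ℕ) (p : ℝ) : ℝ := 2 ^ p * √(2 * ∑' j : Fin n → ℤ, symb j ^ (-p))

/-- `Y₀ = (‖A^p e^{σ𝒜}u₁‖² + ‖A^{p+1} e^{σ𝒜}u₀‖²)^{1/2}`. -/
def initY {n : ℕ} (m : ℕ) (p σ : ℝ) (u₀ u₁ : L2T n) : ℝ :=
  √(gevreyNorm m p σ u₁ ^ 2 + gevreyNorm m (p + 1) σ u₀ ^ 2)

/-- `h₂(t) = (C₀Y₀ + ½ C₀^k (e√2)^k ∫₀ᵗ ‖u(s)‖_{H^p}^k ds)^{k-1}`. -/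
def h₂ {n : ℕ} (m k : ℕ) (p σ : ℝ) (u₀ u₁ : L2T n) (u : ℝ → L2T n) (t : ℝ) : ℝ :=
  (constC₀ n p * initY m p σ u₀ u₁
    + 1 / 2 * constC₀ n p ^ k * (Real.exp 1 * √2) ^ k
      * ∫ s in (0 : ℝ)..t, normH p (coeff (u s)) ^ k) ^ (k - 1)

/-- `φ_j(0) = (|(u₁)_j|² + (1+|j|²)|(u₀)_j|²)^{1/2}`. -/
def phi₀ {n : ℕ} (u₀ u₁ : L2T n) (j : Fin n → ℤ) : ℝ :=
  √(‖coeff u₁ j‖ ^ 2 + symb j * ‖coeff u₀ j‖ ^ 2)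

/-- `y(0) = ∑ⱼ e^{σ|j'|} φ_j(0)`. -/
def initSmallY {n : ℕ} (m : ℕ) (σ : ℝ) (u₀ u₁ : L2T n) : ℝ :=
  ∑' j, Real.exp (σ * absFirst m j) * phi₀ u₀ u₁ j

/-- `h₁(t) = (2y(0) + 2^k e^k ∫₀ᵗ ‖û(s)‖_{ℓ¹}^k ds)^{k-1}`. -/
def h₁ {n : ℕ} (m k : ℕ) (σ : ℝ) (u₀ u₁ : L2T n) (u : ℝ → L2T n) (t : ℝ) : ℝ :=
  (2 * initSmallY m σ u₀ u₁
    + 2 ^ k * Real.exp 1 ^ k * ∫ s in (0 : ℝ)..t, wienerNorm (coeff (u s)) ^ k) ^ (k - 1)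

/-- `τ' = -τ^{k+1} h` on `[0,T]` (one-sided derivatives at the end points), `τ(0) = σ`. -/
def SolvesRadiusODE (k : ℕ) (T σ : ℝ) (h τ : ℝ → ℝ) : Prop :=
  τ 0 = σ ∧ ∀ t ∈ Set.Icc 0 T,
    HasDerivWithinAt τ (-(τ t) ^ (k + 1) * h t) (Set.Icc 0 T) t

end KleinGordon

end

noncomputable section

namespace KleinGordon

/-! ### Weights -/

/-! Persistence of regularity is an energy estimate in which the shrinking radius pays for the
nonlinearity. Testing the weak equation with exponentials turns it into an oscillator for each
Fourier mode, forced by the coefficients `N j` of `u ^ k`. For `G = ∑ (1+|j|²)^p e^{2τθ} E_j`, with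
`E_j` the energy of the mode and `θ` a weight, the linear part cancels. Hence `G' ≤ 2 τ' X + 2 √G
‖N‖`, where `X` is the sum for `G` with an extra factor `θ`, and `‖N‖` is the weighted norm of the
nonlinearity.

The key bound (`nonlinear_estimate`) is `‖N‖ ≤ C₀^(k-1) / √2 * (e^k ‖u‖_{H^p}^k + τ^(k+1) X
G^(k/2-1))`. It combines subadditivity of `θ`, the algebra property of `H^p` (`sqH_conv_le`), the
pointwise splitting `exp_mul_sq_le` according to the size of `τθ`, and an interpolation
(`tsum_rpow_mul_le`) making `X` appear to the first power. The energy controls one derivative more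
of `u` than the norm being estimated; this is the source of the factor `θ²` used in the splitting.

Let `B` be the base of the power `h₂ = B^(k-1)`. As long as `C₀ √G` exceeds `B` by at most a small
factor, `τ' = -τ^(k+1) B^(k-1)` absorbs the `X` term, and what is left grows no faster than `B`. A
barrier argument gives `C₀ √G ≤ B` throughout (`IsModeSystem.gevreyEnergy_le`).

Two a priori difficulties are removed first. The solution is only assumed to lie in `H^p`, but the
nonlinearity is bounded in `H^p`, so the equation of each mode gives energies with a summable bound
uniform in time (`IsModeSystem.exists_summable_energy_bound`). Exponential weights need not be
summable for `t > 0`, so `|j'|` is replaced by `min |j'| M`, whose estimates do not depend on `M`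
(`IsModeSystem.summable_gevrey`).

The comparison of rates is Cauchy–Schwarz against `(1+|j|²)^(-p)`: both `y(0)` and `‖û‖_{ℓ¹}` are
bounded by `(∑ (1+|j|²)^(-p))^(1/2)` times the corresponding `L²` quantity, and `C₀` is large enough
to cover the constants. Since `(τ^(-k))' = k h`, a smaller rate gives a larger radius. -/

lemma one_le_symb {n : ℕ} (j : Fin n → ℤ) : 1 ≤ symb j :=
  le_add_of_nonneg_right (Finset.sum_nonneg fun _ _ => sq_nonneg _)

lemma symb_pos {n : ℕ} (j : Fin n → ℤ) : 0 < symb j := one_pos.trans_le (one_le_symb j)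

lemma symb_rpow_pos {n : ℕ} (s : ℝ) (j : Fin n → ℤ) : 0 < symb j ^ s :=
  Real.rpow_pos_of_pos (symb_pos j) s

lemma symb_add_le {n : ℕ} (a b : Fin n → ℤ) : symb (a + b) ≤ 2 * (symb a + symb b) := by
  have h : ∑ i, ((a + b) i : ℝ) ^ 2 ≤ 2 * (∑ i, (a i : ℝ) ^ 2 + ∑ i, (b i : ℝ) ^ 2) := by
    rw [← Finset.sum_add_distrib, Finset.mul_sum]
    refine Finset.sum_le_sum fun i _ => ?_
    push_cast [Pi.add_apply]
    nlinarith [sq_nonneg ((a i : ℝ) - b i)]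
  unfold symb
  linarith

/-- This replaces subadditivity of the Sobolev weight. The factor `2 ^ p` comes from `symb_add_le`,
the factor `2 ^ (p - 1)` from convexity of the power `p`. -/
lemma symb_rpow_add_le {n : ℕ} {p : ℝ} (hp : 1 ≤ p) (a b : Fin n → ℤ) :
    symb (a + b) ^ p ≤ 2 ^ (2 * p - 1) * (symb a ^ p + symb b ^ p) := by
  have ha := symb_pos a
  have hb := symb_pos b
  have h1 : (symb a + symb b) ^ p ≤ 2 ^ (p - 1) * (symb a ^ p + symb b ^ p) := by
    have := NNReal.rpow_add_le_mul_rpow_add_rpow ⟨symb a, ha.le⟩ ⟨symb b, hb.le⟩ hp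
    exact_mod_cast this
  calc symb (a + b) ^ p ≤ (2 * (symb a + symb b)) ^ p :=
        Real.rpow_le_rpow (symb_pos _).le (symb_add_le a b) (by linarith)
    _ = 2 ^ p * (symb a + symb b) ^ p := Real.mul_rpow (by norm_num) (by positivity)
    _ ≤ 2 ^ p * (2 ^ (p - 1) * (symb a ^ p + symb b ^ p)) := by gcongr
    _ = 2 ^ (2 * p - 1) * (symb a ^ p + symb b ^ p) := by
        rw [← mul_assoc, ← Real.rpow_add two_pos]
        ring_nf

lemma summable_one_add_sq_rpow {r : ℝ} (hr : 1 / 2 < r) :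
    Summable fun a : ℤ => (1 + (a : ℝ) ^ 2) ^ (-r) := by
  have h1 : Summable fun a : ℤ => |(a : ℝ)| ^ (-(2 * r)) :=
    Real.summable_abs_int_rpow (by linarith)
  refine Summable.of_norm_bounded_eventually h1 ?_
  -- The origin is excluded because `0 ^ (-(2 * r))` is `0`, whereas the term there is `1`.
  have : ({0}ᶜ : Set ℤ) ∈ cofinite := (Set.finite_singleton 0).compl_mem_cofinite
  filter_upwards [this] with a ha
  have ha' : (0 : ℝ) < |(a : ℝ)| := abs_pos.mpr (by exact_mod_cast ha)
  rw [Real.norm_of_nonneg (by positivity), neg_mul_eq_mul_neg, Real.rpow_mul ha'.le,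
    Real.rpow_two]
  exact Real.rpow_le_rpow_of_nonpos (by positivity) (by rw [sq_abs]; linarith) (by linarith)

lemma summable_prod_apply {n : ℕ} {g : ℤ → ℝ} (hg : ∀ a, 0 ≤ g a) (hs : Summable g) :
    Summable fun j : Fin n → ℤ => ∏ i, g (j i) := by
  classical
  refine summable_of_sum_le (c := (∑' a, g a) ^ n)
    (fun j => Finset.prod_nonneg fun i _ => hg _) fun F => ?_
  let t : Fin n → Finset ℤ := fun i => F.image fun j => j i
  calc ∑ j ∈ F, ∏ i, g (j i) ≤ ∑ j ∈ Fintype.piFinset t, ∏ i, g (j i) := by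
        refine Finset.sum_le_sum_of_subset_of_nonneg (fun j hj => ?_)
          fun j _ _ => Finset.prod_nonneg fun i _ => hg _
        exact Fintype.mem_piFinset.mpr fun i => Finset.mem_image_of_mem _ hj
    _ = ∏ i, ∑ a ∈ t i, g a := (Finset.prod_univ_sum t fun _ a => g a).symm
    _ ≤ ∏ _i : Fin n, ∑' a, g a :=
        Finset.prod_le_prod (fun i _ => Finset.sum_nonneg fun a _ => hg a)
          fun i _ => hs.sum_le_tsum _ fun a _ => hg a
    _ = _ := by simp

/-- Since `∏ (1 + j_i²) ≤ (1 + |j|²)^n`, the series is dominated by a product of `n` one-dimensional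
series with exponent `p / n > 1 / 2`. -/
lemma summable_symb_rpow {n : ℕ} (hn : 1 ≤ n) {p : ℝ} (hp : (n : ℝ) / 2 < p) :
    Summable fun j : Fin n → ℤ => symb j ^ (-p) := by
  have hn' : (0 : ℝ) < n := by exact_mod_cast hn
  have hr : 1 / 2 < p / n := by rw [lt_div_iff₀ hn']; linarith
  have hp0 : 0 < p := by linarith [div_pos hn' two_pos]
  refine Summable.of_nonneg_of_le (fun j => (symb_rpow_pos _ j).le) (fun j => ?_)
    (summable_prod_apply (fun a => by positivity) (summable_one_add_sq_rpow hr))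
  have h1 : ∏ i, (1 + (j i : ℝ) ^ 2) ≤ symb j ^ n := by
    calc ∏ i, (1 + (j i : ℝ) ^ 2) ≤ ∏ _i : Fin n, symb j := by
          refine Finset.prod_le_prod (fun i _ => by positivity) fun i _ => ?_
          exact add_le_add le_rfl (Finset.single_le_sum (f := fun i => (j i : ℝ) ^ 2)
            (fun i _ => sq_nonneg _) (Finset.mem_univ i))
      _ = symb j ^ n := by simp
  rw [Real.finsetProd_rpow _ _ fun i _ => by positivity]
  calc symb j ^ (-p) = (symb j ^ n) ^ (-(p / n)) := by
        rw [← Real.rpow_natCast, ← Real.rpow_mul (symb_pos j).le]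
        congr 1; field_simp
    _ ≤ _ := Real.rpow_le_rpow_of_nonpos (Finset.prod_pos fun i _ => by positivity) h1
        (by rw [neg_nonpos]; positivity)

lemma absFirst_nonneg {n : ℕ} (m : ℕ) (j : Fin n → ℤ) : 0 ≤ absFirst m j := Real.sqrt_nonneg _

lemma absFirst_sq_le {n : ℕ} (m : ℕ) (j : Fin n → ℤ) : absFirst m j ^ 2 ≤ symb j := by
  rw [absFirst, Real.sq_sqrt (Finset.sum_nonneg fun _ _ => sq_nonneg _), symb]
  have := Finset.sum_le_sum_of_subset_of_nonneg
    (Finset.filter_subset (fun i : Fin n => i.val < m) Finset.univ)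
    (fun i _ _ => sq_nonneg (j i : ℝ))
  linarith

lemma absFirst_add_le {n : ℕ} (m : ℕ) (a b : Fin n → ℤ) :
    absFirst m (a + b) ≤ absFirst m a + absFirst m b := by
  have key : ∀ c : Fin n → ℤ, absFirst m c =
      ‖WithLp.toLp 2 (fun i : Fin n => if i.val < m then (c i : ℝ) else 0)‖ := by
    intro c
    rw [EuclideanSpace.norm_eq, absFirst, Finset.sum_filter]
    congr 1
    refine Finset.sum_congr rfl fun i _ => ?_
    by_cases h : i.val < m
    · rw [if_pos h, PiLp.toLp_apply, if_pos h, Real.norm_eq_abs, sq_abs]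
    · rw [if_neg h, PiLp.toLp_apply, if_neg h, norm_zero, zero_pow two_ne_zero]
  rw [key, key, key]
  refine le_trans (le_of_eq ?_) (norm_add_le _ _)
  congr 1
  ext i
  by_cases h : i.val < m <;> simp [h]

/-- The bounded subadditive weight `min |j'| M`. -/
def cutWeight {n : ℕ} (m : ℕ) (M : ℝ) (j : Fin n → ℤ) : ℝ := min (absFirst m j) M

lemma cutWeight_nonneg {n : ℕ} (m : ℕ) {M : ℝ} (hM : 0 ≤ M) (j : Fin n → ℤ) :
    0 ≤ cutWeight m M j := le_min (absFirst_nonneg m j) hM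

lemma cutWeight_add_le {n : ℕ} (m : ℕ) {M : ℝ} (hM : 0 ≤ M) (a b : Fin n → ℤ) :
    cutWeight m M (a + b) ≤ cutWeight m M a + cutWeight m M b := by
  have h := absFirst_add_le m a b
  have ha := absFirst_nonneg m a
  have hb := absFirst_nonneg m b
  unfold cutWeight
  rcases min_cases (absFirst m a) M with ⟨h1, _⟩ | ⟨h1, _⟩ <;>
  rcases min_cases (absFirst m b) M with ⟨h2, _⟩ | ⟨h2, _⟩ <;> rw [h1, h2]
  · exact (min_le_left _ _).trans h
  · exact (min_le_right _ _).trans (by linarith)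
  · exact (min_le_right _ _).trans (by linarith)
  · exact (min_le_right _ _).trans (by linarith)

/-! ### Iterated convolutions of nonnegative sequences -/

open scoped ENNReal

/-- The `(r+1)`-fold convolution power of a sequence. -/
def convPow {G : Type*} [AddCommGroup G] (f : G → ℝ≥0∞) : ℕ → G → ℝ≥0∞
  | 0 => f
  | r + 1 => fun j => ∑' a, f a * convPow f r (j - a)

lemma convPow_mono {G : Type*} [AddCommGroup G] {f g : G → ℝ≥0∞} (h : ∀ a, f a ≤ g a) (r : ℕ)
    (j : G) : convPow f r j ≤ convPow g r j := by
  induction r generalizing j with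
  | zero => exact h j
  | succ r ih => exact ENNReal.tsum_le_tsum fun a => mul_le_mul' (h a) (ih _)

/-- A submultiplicative weight can be distributed over the factors of a convolution. With `w =
e^{τθ}` this moves the Gevrey weight from the nonlinearity to the solution. -/
lemma mul_convPow_le {G : Type*} [AddCommGroup G] {f w : G → ℝ≥0∞}
    (hw : ∀ a b, w (a + b) ≤ w a * w b) (r : ℕ) (j : G) :
    w j * convPow f r j ≤ convPow (fun a => w a * f a) r j := by
  induction r generalizing j with
  | zero => exact le_rfl
  | succ r ih =>
    simp only [convPow]
    rw [← ENNReal.tsum_mul_left]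
    refine ENNReal.tsum_le_tsum fun a => ?_
    have h := hw a (j - a)
    rw [add_sub_cancel] at h
    calc w j * (f a * convPow f r (j - a))
        ≤ (w a * w (j - a)) * (f a * convPow f r (j - a)) := mul_le_mul_left h _
      _ = w a * f a * (w (j - a) * convPow f r (j - a)) := by ring
      _ ≤ _ := mul_le_mul_right (ih _) _

/-- Cauchy–Schwarz in `[0,∞]`, where no summability has to be carried along. -/
lemma tsum_sq_le_of_sq_le {ι : Type*} {x y z : ι → ℝ≥0∞} (h : ∀ i, x i ^ 2 ≤ y i * z i) :
    (∑' i, x i) ^ 2 ≤ (∑' i, y i) * ∑' i, z i := by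
  have hx : ∀ i, x i ≤ y i ^ (1 / 2 : ℝ) * z i ^ (1 / 2 : ℝ) := fun i => by
    rw [← ENNReal.mul_rpow_of_nonneg _ _ (by norm_num)]
    calc x i = (x i ^ 2) ^ (1 / 2 : ℝ) := by
          rw [← ENNReal.rpow_natCast, ← ENNReal.rpow_mul]; norm_num
      _ ≤ _ := ENNReal.rpow_le_rpow (h i) (by norm_num)
  have hsq : ∀ a : ℝ≥0∞, (a ^ (1 / 2 : ℝ)) ^ (2 : ℝ) = a := fun a => by
    rw [← ENNReal.rpow_mul]; norm_num
  have hfin : ∀ s : Finset ι, ∑ i ∈ s, x i ≤ ((∑' i, y i) * ∑' i, z i) ^ (1 / 2 : ℝ) := fun s => by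
    have hc : (2 : ℝ).HolderConjugate 2 := ⟨by norm_num, by norm_num, by norm_num⟩
    calc ∑ i ∈ s, x i ≤ ∑ i ∈ s, y i ^ (1 / 2 : ℝ) * z i ^ (1 / 2 : ℝ) :=
          Finset.sum_le_sum fun i _ => hx i
      _ ≤ _ := ENNReal.inner_le_Lp_mul_Lq s _ _ hc
      _ ≤ _ := by
          simp only [hsq]
          rw [← ENNReal.mul_rpow_of_nonneg _ _ (by norm_num)]
          exact ENNReal.rpow_le_rpow (mul_le_mul' (ENNReal.sum_le_tsum s) (ENNReal.sum_le_tsum s))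
            (by norm_num)
  have h2 : ∑' i, x i ≤ ((∑' i, y i) * ∑' i, z i) ^ (1 / 2 : ℝ) := by
    rw [ENNReal.tsum_eq_iSup_sum]
    exact iSup_le hfin
  calc (∑' i, x i) ^ 2 ≤ (((∑' i, y i) * ∑' i, z i) ^ (1 / 2 : ℝ)) ^ 2 := pow_le_pow_left' h2 2
    _ = _ := by rw [← ENNReal.rpow_natCast]; exact hsq _

/-- The square of the norm of `H^p`, with values in `[0,∞]`. -/
def sqH {n : ℕ} (p : ℝ) (f : (Fin n → ℤ) → ℝ≥0∞) : ℝ≥0∞ :=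
  ∑' j, ENNReal.ofReal (symb j ^ p) * f j ^ 2

/-- The algebra property of `H^p`: insert the weights `ω a * ω (j - a)` and their inverses, apply
Cauchy–Schwarz for each `j`, and sum the remaining product by Fubini. The constant equals `C₀² / 2`.
-/
lemma sqH_conv_le {n : ℕ} {p : ℝ} (hp : 1 ≤ p) (f g : (Fin n → ℤ) → ℝ≥0∞) :
    sqH p (fun j => ∑' a, f a * g (j - a)) ≤
      ENNReal.ofReal (2 ^ (2 * p)) * (∑' j : Fin n → ℤ, ENNReal.ofReal (symb j ^ (-p)))
        * (sqH p f * sqH p g) := by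
  set ω : (Fin n → ℤ) → ℝ≥0∞ := fun j => ENNReal.ofReal (symb j ^ p) with hω
  set S : ℝ≥0∞ := ∑' j : Fin n → ℤ, (ω j)⁻¹ with hS
  have hω0 : ∀ j, ω j ≠ 0 := fun j => by simp [hω, symb_rpow_pos]
  have hωt : ∀ j, ω j ≠ ∞ := fun j => ENNReal.ofReal_ne_top
  have hS' : (∑' j : Fin n → ℤ, ENNReal.ofReal (symb j ^ (-p))) = S := by
    refine tsum_congr fun j => ?_
    rw [Real.rpow_neg (symb_pos j).le, ENNReal.ofReal_inv_of_pos (symb_rpow_pos p j)]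
  set C : ℝ≥0∞ := ENNReal.ofReal (2 ^ (2 * p - 1)) with hC
  have hωadd : ∀ a b, ω (a + b) ≤ C * (ω a + ω b) := fun a b => by
    simp only [hω, hC]
    rw [← ENNReal.ofReal_add (symb_rpow_pos p a).le (symb_rpow_pos p b).le,
      ← ENNReal.ofReal_mul (by positivity)]
    exact ENNReal.ofReal_le_ofReal (symb_rpow_add_le hp a b)
  -- Dividing the quasi-triangle inequality for `ω` by `ω a * ω (j - a)` leaves two sums, each a
  -- translate or reflection of `S`.
  have hbr : ∀ j, ω j * ∑' a, (ω a)⁻¹ * (ω (j - a))⁻¹ ≤ C * (S + S) := fun j => by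
    rw [← ENNReal.tsum_mul_left]
    calc ∑' a, ω j * ((ω a)⁻¹ * (ω (j - a))⁻¹)
        ≤ ∑' a, C * ((ω (j - a))⁻¹ + (ω a)⁻¹) := by
          refine ENNReal.tsum_le_tsum fun a => ?_
          have h := hωadd a (j - a)
          rw [add_sub_cancel] at h
          calc ω j * ((ω a)⁻¹ * (ω (j - a))⁻¹)
              ≤ C * (ω a + ω (j - a)) * ((ω a)⁻¹ * (ω (j - a))⁻¹) := mul_le_mul_left h _
            _ = C * ((ω a * (ω a)⁻¹) * (ω (j - a))⁻¹
                  + (ω (j - a) * (ω (j - a))⁻¹) * (ω a)⁻¹) := by ring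
            _ = _ := by
                rw [ENNReal.mul_inv_cancel (hω0 _) (hωt _),
                  ENNReal.mul_inv_cancel (hω0 _) (hωt _), one_mul, one_mul]
      _ = C * (S + S) := by
          rw [ENNReal.tsum_mul_left, ENNReal.tsum_add]
          congr 2
          exact (Equiv.subLeft j).tsum_eq fun b => (ω b)⁻¹
  have hpt : ∀ j, ω j * (∑' a, f a * g (j - a)) ^ 2 ≤
      C * (S + S) * ∑' a, (ω a * f a ^ 2) * (ω (j - a) * g (j - a) ^ 2) := fun j => by
    calc ω j * (∑' a, f a * g (j - a)) ^ 2
        ≤ ω j * ((∑' a, (ω a)⁻¹ * (ω (j - a))⁻¹) *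
            ∑' a, (ω a * f a ^ 2) * (ω (j - a) * g (j - a) ^ 2)) := by
          refine mul_le_mul_right (tsum_sq_le_of_sq_le fun a => le_of_eq ?_) _
          calc (f a * g (j - a)) ^ 2 = 1 * 1 * (f a * g (j - a)) ^ 2 := by ring
            _ = (ω a * (ω a)⁻¹) * (ω (j - a) * (ω (j - a))⁻¹) * (f a * g (j - a)) ^ 2 := by
                rw [ENNReal.mul_inv_cancel (hω0 _) (hωt _),
                  ENNReal.mul_inv_cancel (hω0 _) (hωt _)]
            _ = _ := by ring
      _ ≤ _ := by
          rw [← mul_assoc]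
          exact mul_le_mul_left (hbr j) _
  have hCS : C * (S + S) = ENNReal.ofReal (2 ^ (2 * p)) * S := by
    rw [← two_mul, ← mul_assoc]
    congr 1
    rw [hC, show (2 : ℝ≥0∞) = ENNReal.ofReal 2 by simp, ← ENNReal.ofReal_mul (by positivity),
      Real.rpow_sub_one two_ne_zero]
    congr 1; ring
  rw [hS', ← hCS]
  calc sqH p (fun j => ∑' a, f a * g (j - a))
      ≤ ∑' j, C * (S + S) * ∑' a, (ω a * f a ^ 2) * (ω (j - a) * g (j - a) ^ 2) :=
        ENNReal.tsum_le_tsum hpt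
    _ = C * (S + S) * (sqH p f * sqH p g) := by
        rw [ENNReal.tsum_mul_left, ENNReal.tsum_comm]
        congr 1
        simp_rw [ENNReal.tsum_mul_left]
        have : ∀ a, ∑' j, ω (j - a) * g (j - a) ^ 2 = sqH p g := fun a =>
          (Equiv.subRight a).tsum_eq fun b => ω b * g b ^ 2
        simp_rw [this, ENNReal.tsum_mul_right]
        rfl

lemma sqH_convPow_le {n : ℕ} {p : ℝ} (hp : 1 ≤ p) (f : (Fin n → ℤ) → ℝ≥0∞) (r : ℕ) :
    sqH p (convPow f r) ≤
      (ENNReal.ofReal (2 ^ (2 * p)) * ∑' j : Fin n → ℤ, ENNReal.ofReal (symb j ^ (-p))) ^ r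
        * sqH p f ^ (r + 1) := by
  induction r with
  | zero => simp [convPow]
  | succ r ih =>
    refine (sqH_conv_le hp f (convPow f r)).trans ?_
    refine (mul_le_mul_right (mul_le_mul_right ih _) _).trans (le_of_eq ?_)
    ring

end KleinGordon

end

noncomputable section

namespace KleinGordon

/-! ### Fourier coefficients of powers -/

open scoped ENNReal

/-- The monomial `e^{ij·x}` in `L²`. -/
def expL2 {n : ℕ} (j : Fin n → ℤ) : L2T n := UnitAddTorus.mFourierLp 2 j

lemma coeFn_expL2 {n : ℕ} (j : Fin n → ℤ) :
    (expL2 j : UnitAddTorus (Fin n) → ℂ) =ᵐ[torusMeasure n] UnitAddTorus.mFourier j :=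
  UnitAddTorus.coeFn_mFourierLp 2 j

lemma coeff_eq_inner {n : ℕ} (f : L2T n) (j : Fin n → ℤ) : coeff f j = inner ℂ (expL2 j) f := by
  have h := UnitAddTorus.mFourierBasis_repr (d := Fin n) f j
  have h2 := (UnitAddTorus.mFourierBasis (d := Fin n)).repr_apply_apply f j
  rw [UnitAddTorus.coe_mFourierBasis] at h2
  exact h.symm.trans h2

lemma coeff_expL2 {n : ℕ} (i j : Fin n → ℤ) :
    coeff (expL2 i) j = if j = i then 1 else 0 := by
  rw [coeff_eq_inner]
  exact (orthonormal_iff_ite.mp UnitAddTorus.orthonormal_mFourier) j i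

lemma hasSum_coeff_smul {n : ℕ} (f : L2T n) : HasSum (fun j => coeff f j • expL2 j) f :=
  UnitAddTorus.hasSum_mFourier_series_L2 f

/-- The inclusion of the continuous functions into `L²`. -/
def contToL2 (n : ℕ) : C(UnitAddTorus (Fin n), ℂ) →L[ℂ] L2T n :=
  haveI : IsFiniteMeasure (torusMeasure n) := by unfold torusMeasure; infer_instance
  ContinuousMap.toLp 2 (torusMeasure n) ℂ

lemma coeFn_contToL2 {n : ℕ} (F : C(UnitAddTorus (Fin n), ℂ)) :
    (contToL2 n F : UnitAddTorus (Fin n) → ℂ) =ᵐ[torusMeasure n] F :=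
  haveI : IsFiniteMeasure (torusMeasure n) := by unfold torusMeasure; infer_instance
  ContinuousMap.coeFn_toLp (torusMeasure n) F

lemma mFourierCoeff_congr_ae {n : ℕ} {f g : UnitAddTorus (Fin n) → ℂ}
    (h : f =ᵐ[torusMeasure n] g) (j : Fin n → ℤ) :
    UnitAddTorus.mFourierCoeff f j = UnitAddTorus.mFourierCoeff g j :=
  integral_congr_ae (ae_eq_rfl.mul h)

lemma coeff_contToL2 {n : ℕ} (F : C(UnitAddTorus (Fin n), ℂ)) (j : Fin n → ℤ) :
    coeff (contToL2 n F) j = UnitAddTorus.mFourierCoeff F j :=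
  mFourierCoeff_congr_ae (coeFn_contToL2 F) j

/-- Absolutely summable coefficients make the Fourier series converge uniformly; its sum is a
representative whose powers and Fourier coefficients can be manipulated pointwise. -/
lemma exists_continuous_ae_eq {n : ℕ} {f : L2T n} (hf : Summable fun j => ‖coeff f j‖) :
    ∃ F : C(UnitAddTorus (Fin n), ℂ), (f : UnitAddTorus (Fin n) → ℂ) =ᵐ[torusMeasure n] F ∧
      HasSum (fun j => coeff f j • UnitAddTorus.mFourier j) F := by
  have hs : Summable fun j => coeff f j • (UnitAddTorus.mFourier j : C(UnitAddTorus (Fin n), ℂ)) :=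
    .of_norm (by simpa only [norm_smul, UnitAddTorus.mFourier_norm, mul_one] using hf)
  obtain ⟨F, hF⟩ := hs
  have h1 := hF.mapL (contToL2 n)
  have h2 : contToL2 n F = f := by
    refine h1.unique ?_
    simp only [map_smul]
    exact hasSum_coeff_smul f
  refine ⟨F, ?_, hF⟩
  have h3 := coeFn_contToL2 F
  rwa [h2] at h3

lemma mFourierCoeff_mFourier_mul {n : ℕ} (G : C(UnitAddTorus (Fin n), ℂ)) (a j : Fin n → ℤ) :
    UnitAddTorus.mFourierCoeff (UnitAddTorus.mFourier a * G : C(UnitAddTorus (Fin n), ℂ)) j =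
      UnitAddTorus.mFourierCoeff G (j - a) := by
  unfold UnitAddTorus.mFourierCoeff
  congr 1
  ext x
  rw [show -(j - a) = -j + a by abel, UnitAddTorus.mFourier_add]
  simp only [smul_eq_mul, ContinuousMap.mul_apply]
  ring

/-- Multiply the uniformly convergent series of `F` by `G` and apply the functional taking the
`j`-th coefficient, which is continuous in the uniform norm. -/
lemma mFourierCoeff_mul {n : ℕ} {c : (Fin n → ℤ) → ℂ} {F : C(UnitAddTorus (Fin n), ℂ)}
    (hF : HasSum (fun j => c j • UnitAddTorus.mFourier j) F) (G : C(UnitAddTorus (Fin n), ℂ))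
    (j : Fin n → ℤ) :
    UnitAddTorus.mFourierCoeff (F * G : C(UnitAddTorus (Fin n), ℂ)) j =
      ∑' a, c a * UnitAddTorus.mFourierCoeff G (j - a) := by
  have h1 := ((hF.mul_right G).mapL (contToL2 n)).mapL (innerSL ℂ (expL2 j))
  have h2 : ∀ H : C(UnitAddTorus (Fin n), ℂ),
      innerSL ℂ (expL2 j) (contToL2 n H) = UnitAddTorus.mFourierCoeff H j := fun H => by
    rw [← coeff_contToL2, coeff_eq_inner, innerSL_apply_apply]
  simp only [smul_mul_assoc, map_smul, h2, mFourierCoeff_mFourier_mul, smul_eq_mul] at h1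
  exact h1.tsum_eq.symm

lemma enorm_mFourierCoeff_pow_le {n : ℕ} {f : L2T n} (hf : Summable fun j => ‖coeff f j‖) (r : ℕ)
    (j : Fin n → ℤ) :
    ‖UnitAddTorus.mFourierCoeff (fun x => f x ^ (r + 1)) j‖ₑ ≤
      convPow (fun a => ‖coeff f a‖ₑ) r j := by
  obtain ⟨F, hfF, hF⟩ := exists_continuous_ae_eq hf
  have hcF : ∀ j, UnitAddTorus.mFourierCoeff F j = coeff f j := fun j =>
    (mFourierCoeff_congr_ae hfF j).symm
  have hpow : (fun x => f x ^ (r + 1)) =ᵐ[torusMeasure n]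
      (F ^ (r + 1) : C(UnitAddTorus (Fin n), ℂ)) := by
    filter_upwards [hfF] with x hx
    rw [hx, ContinuousMap.pow_apply]
  rw [mFourierCoeff_congr_ae hpow]
  clear hpow
  induction r generalizing j with
  | zero => rw [zero_add, pow_one, hcF]; exact le_rfl
  | succ r ih =>
    rw [pow_succ', mFourierCoeff_mul hF]
    refine enorm_tsum_le_tsum_enorm.trans (ENNReal.tsum_le_tsum fun a => ?_)
    rw [enorm_mul]
    exact mul_le_mul_right (ih _) _

/-- The Fourier coefficients of `u^k`. -/
def powCoeff {n : ℕ} (k : ℕ) (f : L2T n) (j : Fin n → ℤ) : ℂ :=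
  UnitAddTorus.mFourierCoeff (fun x => f x ^ k) j

/-- A single exponential is an admissible test function and isolates one mode. -/
lemma eq_of_weak_equation {n k : ℕ} {ε : ℝ} {f : L2T n} {w : (Fin n → ℤ) → ℂ}
    (h : ∀ φ : L2T n, MemH 1 (coeff φ) →
      pairing w (coeff φ) + pairing (opA (coeff f)) (opA (coeff φ))
        + (ε : ℂ) * ∫ x, f x ^ k * (starRingEnd ℂ) (φ x) ∂(torusMeasure n) = 0)
    (j : Fin n → ℤ) : w j = -(symb j * coeff f j) - ε * powCoeff k f j := by
  have hmem : MemH 1 (coeff (expL2 j)) := by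
    refine summable_of_ne_finset_zero (s := {j}) fun i hi => ?_
    rw [coeff_expL2, if_neg (by simpa using hi)]
    simp
  have h1 := h (expL2 j) hmem
  have h2 : ∀ c : (Fin n → ℤ) → ℂ, pairing c (coeff (expL2 j)) = c j := fun c => by
    unfold pairing
    rw [tsum_eq_single j fun i hi => by rw [coeff_expL2, if_neg hi]; simp, coeff_expL2, if_pos rfl]
    simp
  have h3 : pairing (opA (coeff f)) (opA (coeff (expL2 j))) = symb j * coeff f j := by
    unfold pairing opA
    rw [tsum_eq_single j fun i hi => by rw [coeff_expL2, if_neg hi]; simp, coeff_expL2, if_pos rfl,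
      mul_one, Complex.conj_ofReal, mul_right_comm, ← Complex.ofReal_mul,
      Real.mul_self_sqrt (symb_pos j).le]
  have h4 : ∫ x, f x ^ k * (starRingEnd ℂ) (expL2 j x) ∂(torusMeasure n) = powCoeff k f j := by
    refine integral_congr_ae ?_
    filter_upwards [coeFn_expL2 j] with x hx
    rw [hx, UnitAddTorus.mFourier_neg, smul_eq_mul, mul_comm]
  rw [h2, h3, h4] at h1
  linear_combination h1

end KleinGordon

end

noncomputable section

namespace KleinGordon

open scoped ENNReal

/-! ### The spaces `H^s` as weighted `ℓ²` spaces -/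

lemma symb_term_nonneg {n : ℕ} (s : ℝ) (c : (Fin n → ℤ) → ℂ) (j : Fin n → ℤ) :
    0 ≤ symb j ^ s * ‖c j‖ ^ 2 := mul_nonneg (symb_rpow_pos s j).le (sq_nonneg _)

lemma norm_symb_smul_sq {n : ℕ} (s : ℝ) (c : (Fin n → ℤ) → ℂ) (j : Fin n → ℤ) :
    ‖symb j ^ (s / 2) • c j‖ ^ 2 = symb j ^ s * ‖c j‖ ^ 2 := by
  rw [norm_smul, mul_pow, Real.norm_of_nonneg (symb_rpow_pos _ j).le, ← Real.rpow_natCast,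
    ← Real.rpow_mul (symb_pos j).le]
  congr 2
  push_cast; ring

lemma MemH.memℓp {n : ℕ} {s : ℝ} {c : (Fin n → ℤ) → ℂ} (h : MemH s c) :
    Memℓp (fun j => symb j ^ (s / 2) • c j) 2 := by
  refine (memℓp_gen_iff (by norm_num)).mpr ?_
  simp only [ENNReal.toReal_ofNat, Real.rpow_ofNat, norm_symb_smul_sq]
  exact h

/-- An element of `H^s` as an element of `ℓ²`. -/
def MemH.toEll {n : ℕ} {s : ℝ} {c : (Fin n → ℤ) → ℂ} (h : MemH s c) :
    lp (fun _ : Fin n → ℤ => ℂ) 2 := ⟨fun j => symb j ^ (s / 2) • c j, h.memℓp⟩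

lemma MemH.norm_toEll {n : ℕ} {s : ℝ} {c : (Fin n → ℤ) → ℂ} (h : MemH s c) :
    ‖h.toEll‖ = normH s c := by
  rw [lp.norm_eq_tsum_rpow (by norm_num), normH, Real.sqrt_eq_rpow]
  simp only [ENNReal.toReal_ofNat, Real.rpow_ofNat]
  congr 1
  exact tsum_congr fun j => norm_symb_smul_sq s c j

lemma memH_of_memℓp {n : ℕ} {s : ℝ} {c : (Fin n → ℤ) → ℂ}
    (h : Memℓp (fun j => symb j ^ (s / 2) • c j) 2) : MemH s c := by
  have := (memℓp_gen_iff (by norm_num)).mp h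
  simp only [ENNReal.toReal_ofNat, Real.rpow_ofNat, norm_symb_smul_sq] at this
  exact this

lemma MemH.sub {n : ℕ} {s : ℝ} {c d : (Fin n → ℤ) → ℂ} (hc : MemH s c) (hd : MemH s d) :
    MemH s (c - d) := by
  refine memH_of_memℓp ?_
  convert! hc.memℓp.sub hd.memℓp using 1
  ext j
  simp [smul_sub]

lemma MemH.smul {n : ℕ} {s : ℝ} {c : (Fin n → ℤ) → ℂ} (hc : MemH s c) (a : ℝ) :
    MemH s (a • c) := by
  have h : Summable fun j => a ^ 2 * (symb j ^ s * ‖c j‖ ^ 2) := Summable.mul_left _ hc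
  refine h.congr fun j => ?_
  rw [Pi.smul_apply, norm_smul, mul_pow, Real.norm_eq_abs, sq_abs]
  ring

lemma MemH.mono {n : ℕ} {s s' : ℝ} (hs : s' ≤ s) {c : (Fin n → ℤ) → ℂ} (hc : MemH s c) :
    MemH s' c :=
  Summable.of_nonneg_of_le (symb_term_nonneg s' c)
    (fun j => mul_le_mul_of_nonneg_right (Real.rpow_le_rpow_of_exponent_le (one_le_symb j) hs)
      (sq_nonneg _)) hc

lemma normH_nonneg {n : ℕ} (s : ℝ) (c : (Fin n → ℤ) → ℂ) : 0 ≤ normH s c := Real.sqrt_nonneg _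

lemma normH_sq {n : ℕ} (s : ℝ) (c : (Fin n → ℤ) → ℂ) :
    normH s c ^ 2 = ∑' j, symb j ^ s * ‖c j‖ ^ 2 :=
  Real.sq_sqrt (tsum_nonneg (symb_term_nonneg s c))

lemma MemH.abs_normH_sub_le {n : ℕ} {s : ℝ} {c d : (Fin n → ℤ) → ℂ} (hc : MemH s c)
    (hd : MemH s d) : |normH s c - normH s d| ≤ normH s (c - d) := by
  have h : (hc.sub hd).toEll = hc.toEll - hd.toEll := by
    ext j
    exact smul_sub (symb j ^ (s / 2)) (c j) (d j)
  rw [← hc.norm_toEll, ← hd.norm_toEll, ← (hc.sub hd).norm_toEll, h]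
  exact abs_norm_sub_norm_le _ _

lemma MemH.norm_apply_le {n : ℕ} {s : ℝ} {c : (Fin n → ℤ) → ℂ} (hc : MemH s c)
    (j : Fin n → ℤ) : ‖c j‖ ≤ (symb j ^ (s / 2))⁻¹ * normH s c := by
  have hpos := symb_rpow_pos (s / 2) j
  rw [← hc.norm_toEll, inv_mul_eq_div, le_div_iff₀ hpos]
  have := lp.norm_apply_le_norm (by norm_num) hc.toEll j
  rw [MemH.toEll, norm_smul, Real.norm_of_nonneg hpos.le] at this
  rw [mul_comm]
  exact this

lemma tendsto_apply_of_normH {n : ℕ} {s : ℝ} {α : Type*} {l : Filter α}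
    {f : α → (Fin n → ℤ) → ℂ} (hf : ∀ᶠ a in l, MemH s (f a))
    (h : Tendsto (fun a => normH s (f a)) l (𝓝 0)) (j : Fin n → ℤ) :
    Tendsto (fun a => f a j) l (𝓝 0) := by
  have h1 : Tendsto (fun a => (symb j ^ (s / 2))⁻¹ * normH s (f a)) l (𝓝 0) := by
    simpa using h.const_mul (symb j ^ (s / 2))⁻¹
  exact squeeze_zero_norm' (hf.mono fun a ha => ha.norm_apply_le j) h1

lemma ContinuousInH.memH {n : ℕ} {T s : ℝ} {c : ℝ → (Fin n → ℤ) → ℂ} (h : ContinuousInH T s c)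
    {t : ℝ} (ht : t ∈ Set.Icc 0 T) : MemH s (c t) := (h t ht).1

lemma ContinuousInH.continuousOn_apply {n : ℕ} {T s : ℝ} {c : ℝ → (Fin n → ℤ) → ℂ}
    (h : ContinuousInH T s c) (j : Fin n → ℤ) :
    ContinuousOn (fun t => c t j) (Set.Icc 0 T) := fun t ht => by
  have h1 : ∀ᶠ r in 𝓝[Set.Icc 0 T] t, MemH s (c r - c t) := by
    filter_upwards [self_mem_nhdsWithin] with r hr
    exact (h.memH hr).sub (h.memH ht)
  have h2 := tendsto_apply_of_normH h1 (h t ht).2 j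
  have h3 := h2.add_const (c t j)
  simpa [ContinuousWithinAt] using h3

lemma ContinuousInH.continuousOn_normH {n : ℕ} {T s : ℝ} {c : ℝ → (Fin n → ℤ) → ℂ}
    (h : ContinuousInH T s c) : ContinuousOn (fun t => normH s (c t)) (Set.Icc 0 T) :=
  fun t ht => by
  rw [ContinuousWithinAt, tendsto_iff_norm_sub_tendsto_zero]
  refine squeeze_zero' (Eventually.of_forall fun _ => norm_nonneg _) ?_ (h t ht).2
  filter_upwards [self_mem_nhdsWithin] with r hr
  exact (h.memH hr).abs_normH_sub_le (h.memH ht)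

lemma HasTimeDerivInH.hasDerivWithinAt_apply {n : ℕ} {T s : ℝ} {c c' : ℝ → (Fin n → ℤ) → ℂ}
    (h : HasTimeDerivInH T s c c') (hc : ∀ t ∈ Set.Icc 0 T, MemH s (c t))
    (hc' : ∀ t ∈ Set.Icc 0 T, MemH s (c' t)) (j : Fin n → ℤ) {t : ℝ} (ht : t ∈ Set.Icc 0 T) :
    HasDerivWithinAt (fun t => c t j) (c' t j) (Set.Icc 0 T) t := by
  rw [hasDerivWithinAt_iff_tendsto_slope]
  have h1 : ∀ᶠ r in 𝓝[Set.Icc 0 T \ {t}] t, MemH s ((r - t)⁻¹ • (c r - c t) - c' t) := by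
    filter_upwards [self_mem_nhdsWithin] with r hr
    exact (((hc r hr.1).sub (hc t ht)).smul _).sub (hc' t ht)
  have h2 := (tendsto_apply_of_normH h1 (h t ht) j).add_const (c' t j)
  simpa [slope_fun_def, vsub_eq_sub] using h2

/-! ### Cauchy–Schwarz and the embedding of `H^p` into the Wiener algebra. -/

lemma tsum_mul_le_sqrt_mul_sqrt {ι : Type*} {a b : ι → ℝ} (ha : ∀ i, 0 ≤ a i)
    (hb : ∀ i, 0 ≤ b i) (hA : Summable fun i => a i ^ 2) (hB : Summable fun i => b i ^ 2) :
    Summable (fun i => a i * b i) ∧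
      ∑' i, a i * b i ≤ √(∑' i, a i ^ 2) * √(∑' i, b i ^ 2) := by
  have hc : (2 : ℝ).HolderConjugate 2 := ⟨by norm_num, by norm_num, by norm_num⟩
  constructor
  · refine Summable.of_nonneg_of_le (fun i => mul_nonneg (ha i) (hb i)) (fun i => ?_) (hA.add hB)
    nlinarith [sq_nonneg (a i - b i), sq_nonneg (a i), sq_nonneg (b i)]
  · have := Real.inner_le_Lp_mul_Lq_tsum_of_nonneg hc ha hb (by simpa using hA) (by simpa using hB)
    simpa [Real.sqrt_eq_rpow] using this

lemma wienerNorm_le {n : ℕ} {p : ℝ} (hS : Summable fun j : Fin n → ℤ => symb j ^ (-p))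
    {c : (Fin n → ℤ) → ℂ} (hc : MemH p c) :
    Summable (fun j => ‖c j‖) ∧
      wienerNorm c ≤ √(∑' j : Fin n → ℤ, symb j ^ (-p)) * normH p c := by
  have h1 : ∀ j : Fin n → ℤ, (symb j ^ (-p / 2)) ^ 2 = symb j ^ (-p) := fun j => by
    rw [← Real.rpow_natCast, ← Real.rpow_mul (symb_pos j).le]; congr 1; push_cast; ring
  have h2 : ∀ j : Fin n → ℤ, symb j ^ (-p / 2) * ‖symb j ^ (p / 2) • c j‖ = ‖c j‖ := fun j => by
    rw [norm_smul, Real.norm_of_nonneg (symb_rpow_pos _ j).le, ← mul_assoc,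
      ← Real.rpow_add (symb_pos j)]
    ring_nf
    simp
  have key := tsum_mul_le_sqrt_mul_sqrt (a := fun j : Fin n → ℤ => symb j ^ (-p / 2))
    (b := fun j => ‖symb j ^ (p / 2) • c j‖) (fun j => (symb_rpow_pos _ j).le)
    (fun j => norm_nonneg _) (by simpa only [h1] using hS)
    (by simp only [norm_symb_smul_sq]; exact hc)
  simp only [h1, h2, norm_symb_smul_sq] at key
  exact key

lemma abs_wienerNorm_sub_le {n : ℕ} {c d : (Fin n → ℤ) → ℂ} (hc : Summable fun j => ‖c j‖)
    (hd : Summable fun j => ‖d j‖) : |wienerNorm c - wienerNorm d| ≤ wienerNorm (c - d) := by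
  have hcd : Summable fun j => ‖(c - d) j‖ :=
    Summable.of_nonneg_of_le (fun _ => norm_nonneg _) (fun j => norm_sub_le _ _) (hc.add hd)
  unfold wienerNorm
  rw [← hc.tsum_sub hd, ← Real.norm_eq_abs]
  refine (norm_tsum_le_tsum_norm ?_).trans ?_
  · exact (hc.sub hd).norm
  · exact (hc.sub hd).norm.tsum_le_tsum (fun j => abs_norm_sub_norm_le _ _) hcd

lemma ContinuousInH.continuousOn_wienerNorm {n : ℕ} {T p : ℝ} {c : ℝ → (Fin n → ℤ) → ℂ}
    (hS : Summable fun j : Fin n → ℤ => symb j ^ (-p)) (h : ContinuousInH T p c) :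
    ContinuousOn (fun t => wienerNorm (c t)) (Set.Icc 0 T) := fun t ht => by
  rw [ContinuousWithinAt, tendsto_iff_norm_sub_tendsto_zero]
  have h0 := (h t ht).2.const_mul √(∑' j : Fin n → ℤ, symb j ^ (-p))
  rw [mul_zero] at h0
  refine squeeze_zero' (Eventually.of_forall fun _ => norm_nonneg _) ?_ h0
  filter_upwards [self_mem_nhdsWithin] with r hr
  have hr' := h.memH hr
  have ht' := h.memH ht
  exact (abs_wienerNorm_sub_le (wienerNorm_le hS hr').1 (wienerNorm_le hS ht').1).trans
    (wienerNorm_le hS (hr'.sub ht')).2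

/-! ### Calculus on a compact interval -/

/-- Dominated convergence applied to the slopes: by the mean value inequality the bound on `g' i`
also bounds the slopes of `g i`. This form covers one-sided derivatives at the end points. -/
lemma hasDerivWithinAt_tsum_Icc {ι : Type*} {T : ℝ} {g g' : ι → ℝ → ℝ} {b : ι → ℝ}
    (hb : Summable b) (hg : ∀ i, ∀ t ∈ Set.Icc 0 T, HasDerivWithinAt (g i) (g' i t) (Set.Icc 0 T) t)
    (hg' : ∀ i, ∀ t ∈ Set.Icc 0 T, |g' i t| ≤ b i)
    (hs : ∀ t ∈ Set.Icc 0 T, Summable fun i => g i t) {t : ℝ} (ht : t ∈ Set.Icc 0 T) :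
    HasDerivWithinAt (fun t => ∑' i, g i t) (∑' i, g' i t) (Set.Icc 0 T) t := by
  rw [hasDerivWithinAt_iff_tendsto_slope]
  have h1 : Tendsto (fun r => ∑' i, slope (g i) t r) (𝓝[Set.Icc 0 T \ {t}] t)
      (𝓝 (∑' i, g' i t)) := by
    refine tendsto_tsum_of_dominated_convergence hb
      (fun i => hasDerivWithinAt_iff_tendsto_slope.mp (hg i t ht)) ?_
    filter_upwards [self_mem_nhdsWithin] with r hr i
    have h2 := (convex_Icc 0 T).norm_image_sub_le_of_norm_hasDerivWithin_le (hg i)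
      (fun x hx => hg' i x hx) ht hr.1
    have hpos : 0 < |r - t| := abs_pos.mpr (sub_ne_zero.mpr hr.2)
    rw [slope_def_field, norm_div, Real.norm_eq_abs (r - t), div_le_iff₀ hpos]
    exact h2
  refine h1.congr' ?_
  filter_upwards [self_mem_nhdsWithin] with r hr
  simp only [slope_def_field]
  rw [tsum_div_const, (hs r hr.1).tsum_sub (hs t ht)]

lemma hasDerivWithinAt_integral_Icc {T : ℝ} {f : ℝ → ℝ} (hf : ContinuousOn f (Set.Icc 0 T)) {t : ℝ}
    (ht : t ∈ Set.Icc 0 T) :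
    HasDerivWithinAt (fun t => ∫ s in (0 : ℝ)..t, f s) (f t) (Set.Icc 0 T) t := by
  have : Fact (t ∈ Set.Icc 0 T) := ⟨ht⟩
  refine intervalIntegral.integral_hasDerivWithinAt_right ?_ ?_ (hf t ht)
  · exact (hf.mono (by rw [Set.uIcc_of_le ht.1]; exact Set.Icc_subset_Icc_right ht.2)).intervalIntegrable
  · exact hf.stronglyMeasurableAtFilter_nhdsWithin measurableSet_Icc t

end KleinGordon

end

noncomputable section

namespace KleinGordon

open scoped ENNReal

/-! ### The nonlinear estimate -/

/-- Hölder interpolation, obtained by summing the tangent-line (Bernoulli) bound for the concave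
function `θ ^ q` at a point `r` and then choosing `r`. -/
lemma tsum_rpow_mul_le {ι : Type*} {θ g : ι → ℝ} (hθ : ∀ i, 0 ≤ θ i) (hg : ∀ i, 0 ≤ g i)
    (hG : Summable g) (hX : Summable fun i => θ i * g i) {q : ℝ} (hq0 : 0 < q) (hq1 : q ≤ 1) :
    Summable (fun i => θ i ^ q * g i) ∧
      ∑' i, θ i ^ q * g i ≤ (∑' i, θ i * g i) ^ q * (∑' i, g i) ^ (1 - q) := by
  have hbern : ∀ r : ℝ, 0 < r → ∀ i, θ i ^ q ≤ r ^ q * (1 + q * (θ i / r - 1)) := fun r hr i => by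
    have h := rpow_one_add_le_one_add_mul_self (s := θ i / r - 1)
      (by linarith [div_nonneg (hθ i) hr.le]) hq0.le hq1
    rw [add_sub_cancel, Real.div_rpow (hθ i) hr.le, div_le_iff₀ (Real.rpow_pos_of_pos hr q)] at h
    linarith
  have hle : ∀ r : ℝ, 0 < r → ∀ i, θ i ^ q * g i ≤
      r ^ q * ((1 - q) * g i + q / r * (θ i * g i)) := fun r hr i => by
    refine (mul_le_mul_of_nonneg_right (hbern r hr i) (hg i)).trans (le_of_eq ?_)
    ring
  have hsr : ∀ r : ℝ, Summable fun i => r ^ q * ((1 - q) * g i + q / r * (θ i * g i)) :=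
    fun r => ((hG.mul_left _).add (hX.mul_left _)).mul_left _
  have hs : Summable fun i => θ i ^ q * g i :=
    Summable.of_nonneg_of_le (fun i => mul_nonneg (Real.rpow_nonneg (hθ i) q) (hg i))
      (hle 1 one_pos) (hsr 1)
  refine ⟨hs, ?_⟩
  have hX0 : 0 ≤ ∑' i, θ i * g i := tsum_nonneg fun i => mul_nonneg (hθ i) (hg i)
  have hG0 : 0 ≤ ∑' i, g i := tsum_nonneg hg
  rcases hX0.eq_or_lt with h0 | hXpos
  · have hz : ∀ i, θ i ^ q * g i = 0 := fun i => by
      have := (hX.hasSum_iff.mpr h0.symm)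
      have h1 := (hasSum_zero_iff_of_nonneg fun i => mul_nonneg (hθ i) (hg i)).mp this
      rcases mul_eq_zero.mp (congrFun h1 i) with h2 | h2
      · rw [h2, Real.zero_rpow hq0.ne', zero_mul]
      · rw [h2, mul_zero]
    simp only [hz, tsum_zero]
    positivity
  · have hGpos : 0 < ∑' i, g i := by
      refine hG0.lt_of_ne fun h0 => hXpos.ne ?_
      have h1 := (hasSum_zero_iff_of_nonneg hg).mp (hG.hasSum_iff.mpr h0.symm)
      simp [h1]
    set X := ∑' i, θ i * g i
    set G := ∑' i, g i
    -- The `g`-weighted mean of `θ` is the choice of `r` for which the linear correction sums to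
    -- zero.
    have hr : 0 < X / G := div_pos hXpos hGpos
    calc ∑' i, θ i ^ q * g i
        ≤ ∑' i, (X / G) ^ q * ((1 - q) * g i + q / (X / G) * (θ i * g i)) :=
          hs.tsum_le_tsum (hle _ hr) (hsr _)
      _ = (X / G) ^ q * ((1 - q) * G + q / (X / G) * X) := by
          rw [tsum_mul_left, (hG.mul_left _).tsum_add (hX.mul_left _), tsum_mul_left,
            tsum_mul_left]
      _ = (X / G) ^ q * G := by
          congr 1
          field_simp
          ring
      _ = X ^ q * G ^ (1 - q) := by
          rw [Real.div_rpow hXpos.le hGpos.le, Real.rpow_sub hGpos, Real.rpow_one]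
          ring

lemma summable_and_tsum_le_of_convPow {n : ℕ} {p : ℝ} (hp : 1 ≤ p)
    (hS : Summable fun j : Fin n → ℤ => symb j ^ (-p)) {f x : (Fin n → ℤ) → ℝ} {r : ℕ}
    (hf0 : ∀ j, 0 ≤ f j) (hf : Summable fun j => symb j ^ p * f j ^ 2) (hx0 : ∀ j, 0 ≤ x j)
    (hx : ∀ j, ENNReal.ofReal (x j) ≤ convPow (fun a => ENNReal.ofReal (f a)) r j) :
    Summable (fun j => symb j ^ p * x j ^ 2) ∧
      ∑' j, symb j ^ p * x j ^ 2 ≤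
        (constC₀ n p ^ 2 / 2) ^ r * (∑' j, symb j ^ p * f j ^ 2) ^ (r + 1) := by
  have hterm : ∀ {y : (Fin n → ℤ) → ℝ}, (∀ j, 0 ≤ y j) → ∀ j,
      ENNReal.ofReal (symb j ^ p * y j ^ 2) =
        ENNReal.ofReal (symb j ^ p) * ENNReal.ofReal (y j) ^ 2 := fun hy j => by
    rw [ENNReal.ofReal_mul (symb_rpow_pos p j).le, ENNReal.ofReal_pow (hy j)]
  have hnn : ∀ (y : (Fin n → ℤ) → ℝ) j, 0 ≤ symb j ^ p * y j ^ 2 := fun y j =>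
    mul_nonneg (symb_rpow_pos p j).le (sq_nonneg _)
  set F := ∑' j, symb j ^ p * f j ^ 2 with hF
  set S := ∑' j : Fin n → ℤ, symb j ^ (-p) with hSdef
  have hS0 : 0 ≤ S := tsum_nonneg fun j => (symb_rpow_pos _ j).le
  have hF0 : 0 ≤ F := tsum_nonneg (hnn f)
  have hsqF : sqH p (fun a => ENNReal.ofReal (f a)) = ENNReal.ofReal F := by
    rw [hF, ENNReal.ofReal_tsum_of_nonneg (hnn f) hf]
    exact tsum_congr fun j => (hterm hf0 j).symm
  have hC : constC₀ n p ^ 2 / 2 = 2 ^ (2 * p) * S := by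
    rw [constC₀, mul_pow, Real.sq_sqrt (by positivity), ← Real.rpow_natCast,
      ← Real.rpow_mul two_pos.le, Nat.cast_two, mul_comm p 2, ← hSdef]
    ring
  have htot : ∑' j, ENNReal.ofReal (symb j ^ p * x j ^ 2) ≤
      ENNReal.ofReal ((constC₀ n p ^ 2 / 2) ^ r * F ^ (r + 1)) := by
    calc ∑' j, ENNReal.ofReal (symb j ^ p * x j ^ 2)
        ≤ sqH p (convPow (fun a => ENNReal.ofReal (f a)) r) := by
          refine ENNReal.tsum_le_tsum fun j => ?_
          rw [hterm hx0]
          exact mul_le_mul_right (pow_le_pow_left' (hx j) 2) _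
      _ ≤ _ := sqH_convPow_le hp _ r
      _ = _ := by
          rw [hsqF, ← ENNReal.ofReal_tsum_of_nonneg (fun j => (symb_rpow_pos _ j).le) hS, hC,
            ENNReal.ofReal_mul (by positivity), ENNReal.ofReal_pow (by positivity),
            ENNReal.ofReal_pow hF0, ENNReal.ofReal_mul (by positivity)]
  have hfin : ∀ s : Finset (Fin n → ℤ), ∑ j ∈ s, symb j ^ p * x j ^ 2 ≤
      (constC₀ n p ^ 2 / 2) ^ r * F ^ (r + 1) := fun s => by
    rw [← ENNReal.ofReal_le_ofReal_iff (by positivity),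
      ENNReal.ofReal_sum_of_nonneg fun j _ => hnn x j]
    exact (ENNReal.sum_le_tsum s).trans htot
  have hs := summable_of_sum_le (hnn x) hfin
  exact ⟨hs, hs.tsum_le_of_sum_le hfin⟩

/-- If `τθ ≤ 1` the exponential is at most `e`. Otherwise a factor `(τθ)^(2(κ+1)/κ) ≥ 1` may be
inserted; its exponent is `2 + 2/κ`, so `θ²` is spent on `h` and `θ^(2/κ)` remains. -/
lemma exp_mul_sq_le {τ θ a e κ : ℝ} (hτ : 0 ≤ τ) (hθ : 0 ≤ θ) (ha : 0 ≤ a) (hκ : 0 < κ)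
    (h : θ ^ 2 * a ^ 2 ≤ e) :
    (Real.exp (τ * θ) * a) ^ 2 ≤ Real.exp 1 ^ 2 * a ^ 2 +
      τ ^ (2 * (κ + 1) / κ) * (θ ^ (2 / κ) * (Real.exp (2 * τ * θ) * e)) := by
  have he : 0 ≤ e := le_trans (by positivity) h
  have hexp : Real.exp (2 * τ * θ) = Real.exp (τ * θ) ^ 2 := by
    rw [← Real.exp_nat_mul]; congr 1; push_cast; ring
  rcases le_total (τ * θ) 1 with h1 | h1
  · have : (Real.exp (τ * θ) * a) ^ 2 ≤ Real.exp 1 ^ 2 * a ^ 2 := by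
      rw [← mul_pow]
      gcongr
    exact this.trans (le_add_of_nonneg_right (by positivity))
  · have h2 : 1 ≤ (τ * θ) ^ (2 * (κ + 1) / κ) := Real.one_le_rpow h1 (by positivity)
    have h3 : (τ * θ) ^ (2 * (κ + 1) / κ) = τ ^ (2 * (κ + 1) / κ) * (θ ^ (2 / κ) * θ ^ 2) := by
      rw [Real.mul_rpow hτ hθ]
      congr 1
      have hpos : 0 < θ := by
        rcases hθ.eq_or_lt with h0 | h0
        · rw [← h0, mul_zero] at h1; linarith
        · exact h0
      rw [← Real.rpow_natCast, ← Real.rpow_add hpos]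
      congr 1
      push_cast
      field_simp
      ring
    calc (Real.exp (τ * θ) * a) ^ 2 = 1 * (Real.exp (2 * τ * θ) * a ^ 2) := by rw [hexp]; ring
      _ ≤ (τ * θ) ^ (2 * (κ + 1) / κ) * (Real.exp (2 * τ * θ) * a ^ 2) := by gcongr
      _ = τ ^ (2 * (κ + 1) / κ) * (θ ^ (2 / κ) * (Real.exp (2 * τ * θ) * (θ ^ 2 * a ^ 2))) := by
          rw [h3]; ring
      _ ≤ τ ^ (2 * (κ + 1) / κ) * (θ ^ (2 / κ) * (Real.exp (2 * τ * θ) * e)) := by gcongr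
      _ ≤ _ := le_add_of_nonneg_left (by positivity)

lemma constC₀_nonneg (n : ℕ) (p : ℝ) : 0 ≤ constC₀ n p := by
  unfold constC₀; positivity

/-- Convexity costs `2^(k/2-1)`, the constant supplies `2^(-(k-1)/2)`, and the product is `1/√2` for
every `k`. This factor is the slack that the barrier argument uses later. -/
lemma sqrt_mul_add_pow_le {C A B : ℝ} (hC : 0 ≤ C) (hA : 0 ≤ A) (hB : 0 ≤ B) {k : ℕ}
    (hk : 2 ≤ k) :
    √((C ^ 2 / 2) ^ (k - 1) * (A + B) ^ k) ≤
      C ^ (k - 1) / √2 * (A ^ ((k : ℝ) / 2) + B ^ ((k : ℝ) / 2)) := by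
  obtain ⟨r, rfl⟩ : ∃ r, k = r + 1 := ⟨k - 1, by omega⟩
  have hκ : (1 : ℝ) ≤ ((r + 1 : ℕ) : ℝ) / 2 := by
    rw [le_div_iff₀ two_pos]; exact_mod_cast hk
  have h1 : (A + B) ^ (((r + 1 : ℕ) : ℝ) / 2) ≤ 2 ^ (((r + 1 : ℕ) : ℝ) / 2 - 1) *
      (A ^ (((r + 1 : ℕ) : ℝ) / 2) + B ^ (((r + 1 : ℕ) : ℝ) / 2)) := by
    have := NNReal.rpow_add_le_mul_rpow_add_rpow ⟨A, hA⟩ ⟨B, hB⟩ hκ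
    exact_mod_cast this
  have h2 : √((C ^ 2 / 2) ^ r * (A + B) ^ (r + 1)) =
      (C / √2) ^ r * (A + B) ^ (((r + 1 : ℕ) : ℝ) / 2) := by
    rw [Real.sqrt_mul (by positivity)]
    congr 1
    · rw [← Real.sqrt_sq (show 0 ≤ (C / √2) ^ r by positivity)]
      congr 1
      rw [← pow_mul, mul_comm r 2, pow_mul, div_pow C √2 2, Real.sq_sqrt two_pos.le]
    · rw [Real.sqrt_eq_rpow, ← Real.rpow_natCast (A + B), ← Real.rpow_mul (by positivity)]
      congr 1
      ring
  have h3 : (1 / √2) ^ r * (2 : ℝ) ^ (((r + 1 : ℕ) : ℝ) / 2 - 1) = 1 / √2 := by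
    have : (1 / √2 : ℝ) = 2 ^ (-(1 / 2) : ℝ) := by
      rw [Real.rpow_neg two_pos.le, Real.sqrt_eq_rpow, one_div]
    rw [this, ← Real.rpow_natCast, ← Real.rpow_mul two_pos.le, ← Real.rpow_add two_pos]
    congr 1
    push_cast
    ring
  rw [Nat.add_sub_cancel, h2]
  calc (C / √2) ^ r * (A + B) ^ (((r + 1 : ℕ) : ℝ) / 2)
      ≤ (C / √2) ^ r * (2 ^ (((r + 1 : ℕ) : ℝ) / 2 - 1) *
      (A ^ (((r + 1 : ℕ) : ℝ) / 2) + B ^ (((r + 1 : ℕ) : ℝ) / 2))) := by gcongr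
    _ = C ^ r * ((1 / √2) ^ r * (2 : ℝ) ^ (((r + 1 : ℕ) : ℝ) / 2 - 1)) *
        (A ^ (((r + 1 : ℕ) : ℝ) / 2) + B ^ (((r + 1 : ℕ) : ℝ) / 2)) := by
        rw [div_eq_mul_one_div C, mul_pow]; ring
    _ = _ := by rw [h3]; ring

/-- After the weight is distributed over the factors, the `H^p` algebra bound leaves the `k/2`-th
power of a low-frequency part `A` plus a high-frequency part `B`. The exponent `2/k` in `B` is
chosen so that this power is linear in the dissipation. The bound `M` on `θ` only gives convergence
and does not enter the estimate. -/
lemma nonlinear_estimate {n k : ℕ} (hk : 2 ≤ k) {p τ M : ℝ} (hp : 1 ≤ p)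
    (hS : Summable fun j : Fin n → ℤ => symb j ^ (-p)) (hτ : 0 ≤ τ)
    {θ e : (Fin n → ℤ) → ℝ} {c N : (Fin n → ℤ) → ℂ} (hθ : ∀ j, 0 ≤ θ j)
    (hθadd : ∀ a b, θ (a + b) ≤ θ a + θ b) (hθs : ∀ j, θ j ^ 2 ≤ symb j) (hθM : ∀ j, θ j ≤ M)
    (hc : MemH p c) (he : ∀ j, symb j * ‖c j‖ ^ 2 ≤ e j)
    (hG : Summable fun j => symb j ^ p * Real.exp (2 * τ * θ j) * e j)
    (hN : ∀ j, ‖N j‖ₑ ≤ convPow (fun a => ‖c a‖ₑ) (k - 1) j) :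
    Summable (fun j => symb j ^ p * (Real.exp (τ * θ j) * ‖N j‖) ^ 2) ∧
      √(∑' j, symb j ^ p * (Real.exp (τ * θ j) * ‖N j‖) ^ 2) ≤
        constC₀ n p ^ (k - 1) / √2 * (Real.exp 1 ^ k * normH p c ^ k +
          τ ^ (k + 1) * (∑' j, θ j * (symb j ^ p * Real.exp (2 * τ * θ j) * e j)) *
            (∑' j, symb j ^ p * Real.exp (2 * τ * θ j) * e j) ^ ((k : ℝ) / 2 - 1)) := by
  have hk0 : (0 : ℝ) < k := by exact_mod_cast (by omega : 0 < k)
  have hk2 : (2 : ℝ) ≤ k := by exact_mod_cast hk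
  set g : (Fin n → ℤ) → ℝ := fun j => symb j ^ p * Real.exp (2 * τ * θ j) * e j with hg
  have he0 : ∀ j, 0 ≤ e j := fun j =>
    (mul_nonneg (symb_pos j).le (sq_nonneg _)).trans (he j)
  have hg0 : ∀ j, 0 ≤ g j := fun j =>
    mul_nonneg (mul_nonneg (symb_rpow_pos p j).le (Real.exp_pos _).le) (he0 j)
  have hX : Summable fun j => θ j * g j :=
    Summable.of_nonneg_of_le (fun j => mul_nonneg (hθ j) (hg0 j))
      (fun j => mul_le_mul_of_nonneg_right (hθM j) (hg0 j)) (hG.mul_left M)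
  set X := ∑' j, θ j * g j
  set G := ∑' j, g j
  have hX0 : 0 ≤ X := tsum_nonneg fun j => mul_nonneg (hθ j) (hg0 j)
  have hG0 : 0 ≤ G := tsum_nonneg hg0
  obtain ⟨hint, hintle⟩ := tsum_rpow_mul_le hθ hg0 hG hX (q := 2 / k) (by positivity)
    ((div_le_one hk0).mpr hk2)
  set f : (Fin n → ℤ) → ℝ := fun j => Real.exp (τ * θ j) * ‖c j‖ with hf
  have hf0 : ∀ j, 0 ≤ f j := fun j => by positivity
  have hfle : ∀ j, symb j ^ p * f j ^ 2 ≤ Real.exp 1 ^ 2 * (symb j ^ p * ‖c j‖ ^ 2) +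
      τ ^ (2 * ((k : ℝ) + 1) / k) * (θ j ^ (2 / (k : ℝ)) * g j) := fun j => by
    have h1 := exp_mul_sq_le hτ (hθ j) (norm_nonneg (c j)) hk0
      ((mul_le_mul_of_nonneg_right (hθs j) (sq_nonneg _)).trans (he j))
    refine (mul_le_mul_of_nonneg_left h1 (symb_rpow_pos p j).le).trans (le_of_eq ?_)
    simp only [hg]
    ring
  have hsum := (Summable.mul_left (Real.exp 1 ^ 2) hc).add
    (hint.mul_left (τ ^ (2 * ((k : ℝ) + 1) / k)))
  have hfs : Summable fun j => symb j ^ p * f j ^ 2 :=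
    Summable.of_nonneg_of_le (fun j => mul_nonneg (symb_rpow_pos p j).le (sq_nonneg _)) hfle hsum
  set A := Real.exp 1 ^ 2 * normH p c ^ 2 with hA
  set B := τ ^ (2 * ((k : ℝ) + 1) / k) * (X ^ (2 / (k : ℝ)) * G ^ (1 - 2 / (k : ℝ))) with hB
  have hA0 : 0 ≤ A := by positivity
  have hB0 : 0 ≤ B := by positivity
  have hftot : ∑' j, symb j ^ p * f j ^ 2 ≤ A + B := by
    refine (hfs.tsum_le_tsum hfle hsum).trans ?_
    rw [(Summable.mul_left (Real.exp 1 ^ 2) hc).tsum_add (hint.mul_left _), tsum_mul_left,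
      tsum_mul_left, ← normH_sq]
    exact add_le_add le_rfl (mul_le_mul_of_nonneg_left hintle (by positivity))
  have hx : ∀ j, ENNReal.ofReal (Real.exp (τ * θ j) * ‖N j‖) ≤
      convPow (fun a => ENNReal.ofReal (f a)) (k - 1) j := fun j => by
    have h1 := mul_convPow_le (w := fun a => ENNReal.ofReal (Real.exp (τ * θ a)))
      (f := fun a => ‖c a‖ₑ) (fun a b => by
        rw [← ENNReal.ofReal_mul (Real.exp_pos _).le, ← Real.exp_add]
        refine ENNReal.ofReal_le_ofReal (Real.exp_le_exp.mpr ?_)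
        nlinarith [hθadd a b]) (k - 1) j
    have h2 : (fun a => ENNReal.ofReal (f a)) =
        fun a => ENNReal.ofReal (Real.exp (τ * θ a)) * ‖c a‖ₑ := by
      ext a
      rw [hf, ENNReal.ofReal_mul (Real.exp_pos _).le, ofReal_norm]
    rw [h2, ENNReal.ofReal_mul (Real.exp_pos _).le, ofReal_norm]
    exact (mul_le_mul_right (hN j) _).trans h1
  obtain ⟨hNs, hNle⟩ := summable_and_tsum_le_of_convPow hp hS hf0 hfs
    (fun j => by positivity) hx
  refine ⟨hNs, ?_⟩
  rw [show k - 1 + 1 = k by omega] at hNle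
  have hC0 := constC₀_nonneg n p
  have hfin : ∑' j, symb j ^ p * (Real.exp (τ * θ j) * ‖N j‖) ^ 2 ≤
      (constC₀ n p ^ 2 / 2) ^ (k - 1) * (A + B) ^ k := by
    refine hNle.trans ?_
    have : 0 ≤ ∑' j, symb j ^ p * f j ^ 2 :=
      tsum_nonneg fun j => mul_nonneg (symb_rpow_pos p j).le (sq_nonneg _)
    gcongr
  refine (Real.sqrt_le_sqrt hfin).trans ((sqrt_mul_add_pow_le hC0 hA0 hB0 hk).trans
    (le_of_eq ?_))
  have hAk : A ^ ((k : ℝ) / 2) = Real.exp 1 ^ k * normH p c ^ k := by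
    have : 0 ≤ Real.exp 1 * normH p c := mul_nonneg (Real.exp_pos _).le (normH_nonneg p c)
    rw [hA, ← mul_pow, ← mul_pow, ← Real.rpow_natCast, ← Real.rpow_mul this, ← Real.rpow_natCast]
    congr 1
    push_cast
    ring
  have hBk : B ^ ((k : ℝ) / 2) = τ ^ (k + 1) * X * G ^ ((k : ℝ) / 2 - 1) := by
    rw [hB, Real.mul_rpow (by positivity) (by positivity),
      Real.mul_rpow (by positivity) (by positivity), ← Real.rpow_mul hτ, ← Real.rpow_mul hX0,
      ← Real.rpow_mul hG0, ← Real.rpow_natCast τ, mul_assoc]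
    congr 2
    · push_cast; field_simp
    · rw [show 2 / (k : ℝ) * (k / 2) = 1 by field_simp, Real.rpow_one]
    · congr 1; field_simp
  rw [hAk, hBk]

end KleinGordon

end

noncomputable section

namespace KleinGordon

open scoped ENNReal

/-! ### Energies of the Fourier modes -/

/-- The equation for the Fourier modes, with `N` the modes of the nonlinearity. -/
structure IsModeSystem {n : ℕ} (k : ℕ) (ε T p : ℝ) (c v N : ℝ → (Fin n → ℤ) → ℂ) : Prop where
  deriv_c : ∀ j, ∀ t ∈ Set.Icc 0 T,
    HasDerivWithinAt (fun t => c t j) (v t j) (Set.Icc 0 T) t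
  deriv_v : ∀ j, ∀ t ∈ Set.Icc 0 T,
    HasDerivWithinAt (fun t => v t j) (-(symb j * c t j) - ε * N t j) (Set.Icc 0 T) t
  cont_N : ∀ j, ContinuousOn (fun t => N t j) (Set.Icc 0 T)
  enorm_N_le : ∀ t ∈ Set.Icc 0 T, ∀ j, ‖N t j‖ₑ ≤ convPow (fun a => ‖c t a‖ₑ) (k - 1) j
  cont_c : ContinuousInH T p c

/-- The energy of a mode. -/
def energy {n : ℕ} (c v : (Fin n → ℤ) → ℂ) (j : Fin n → ℤ) : ℝ :=
  ‖v j‖ ^ 2 + symb j * ‖c j‖ ^ 2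

lemma energy_nonneg {n : ℕ} (c v : (Fin n → ℤ) → ℂ) (j : Fin n → ℤ) : 0 ≤ energy c v j := by
  have := (symb_pos j).le
  unfold energy; positivity

lemma symb_mul_le_energy {n : ℕ} (c v : (Fin n → ℤ) → ℂ) (j : Fin n → ℤ) :
    symb j * ‖c j‖ ^ 2 ≤ energy c v j := le_add_of_nonneg_left (sq_nonneg _)

lemma sq_le_energy_left {n : ℕ} (c v : (Fin n → ℤ) → ℂ) (j : Fin n → ℤ) :
    ‖c j‖ ^ 2 ≤ energy c v j :=
  (le_mul_of_one_le_left (sq_nonneg _) (one_le_symb j)).trans (symb_mul_le_energy c v j)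

lemma sq_le_energy_right {n : ℕ} (c v : (Fin n → ℤ) → ℂ) (j : Fin n → ℤ) :
    ‖v j‖ ^ 2 ≤ energy c v j :=
  le_add_of_nonneg_right (mul_nonneg (symb_pos j).le (sq_nonneg _))

variable {n k : ℕ} {ε T p : ℝ} {c v N : ℝ → (Fin n → ℤ) → ℂ}

lemma IsModeSystem.hasDerivWithinAt_energy (h : IsModeSystem k ε T p c v N) (j : Fin n → ℤ) {t : ℝ}
    (ht : t ∈ Set.Icc 0 T) :
    HasDerivWithinAt (fun t => energy (c t) (v t) j) (-(2 * ε * inner ℝ (v t j) (N t j)))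
      (Set.Icc 0 T) t := by
  have h1 := (h.deriv_v j t ht).norm_sq.add ((h.deriv_c j t ht).norm_sq.const_mul (symb j))
  convert! h1 using 1
  have e1 : -((symb j : ℂ) * c t j) - ε * N t j = -(symb j • c t j) - ε • N t j := by simp
  rw [e1, inner_sub_right, inner_neg_right, inner_smul_right, inner_smul_right,
    real_inner_comm (v t j) (c t j)]
  ring

lemma IsModeSystem.abs_deriv_energy_le (hε : |ε| = 1) (x y : ℂ) :
    |-(2 * ε * inner ℝ x y)| ≤ 2 * (‖x‖ * ‖y‖) := by
  rw [abs_neg, abs_mul, abs_mul, hε, abs_two, mul_one]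
  exact mul_le_mul_of_nonneg_left (abs_real_inner_le_norm x y) two_pos.le

/-- Gronwall for one mode, via `2 |v| |N| ≤ |v|² + |N|²`: the function `e^{-s} E - ∫ |N|²` is
nonincreasing. -/
lemma IsModeSystem.energy_le (h : IsModeSystem k ε T p c v N) (hε : |ε| = 1) (j : Fin n → ℤ) {t : ℝ}
    (ht : t ∈ Set.Icc 0 T) :
    energy (c t) (v t) j ≤
      Real.exp T * (energy (c 0) (v 0) j + ∫ s in (0 : ℝ)..T, ‖N s j‖ ^ 2) := by
  have h0 : (0 : ℝ) ∈ Set.Icc 0 T := ⟨le_rfl, ht.1.trans ht.2⟩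
  have hNc : ContinuousOn (fun s => ‖N s j‖ ^ 2) (Set.Icc 0 T) := (h.cont_N j).norm.pow 2
  have hint : ∀ s ∈ Set.Icc 0 T, IntervalIntegrable (fun s => ‖N s j‖ ^ 2) volume 0 s :=
    fun s hs => (hNc.mono (by
      rw [Set.uIcc_of_le hs.1]; exact Set.Icc_subset_Icc_right hs.2)).intervalIntegrable
  have hd : ∀ s ∈ Set.Icc 0 T, HasDerivWithinAt
      (fun s => Real.exp (-s) * energy (c s) (v s) j - ∫ r in (0 : ℝ)..s, ‖N r j‖ ^ 2)
      ((Real.exp (-s) * (-1) * energy (c s) (v s) j +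
        Real.exp (-s) * (-(2 * ε * inner ℝ (v s j) (N s j)))) - ‖N s j‖ ^ 2)
      (Set.Icc 0 T) s := fun s hs =>
    (((hasDerivAt_neg s).exp.hasDerivWithinAt.mul (h.hasDerivWithinAt_energy j hs)).sub
      (hasDerivWithinAt_integral_Icc hNc hs))
  have hanti := antitoneOn_of_hasDerivWithinAt_nonpos (convex_Icc 0 T)
    (fun s hs => (hd s hs).continuousWithinAt)
    (fun s hs => (hd s (interior_subset hs)).mono interior_subset) (fun s hs => by
      have hs0 : 0 ≤ s := (interior_subset hs).1
      have h1 := (abs_le.mp (IsModeSystem.abs_deriv_energy_le hε (v s j) (N s j))).2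
      have h2 := sq_le_energy_right (c s) (v s) j
      have h3 : 2 * (‖v s j‖ * ‖N s j‖) ≤ ‖v s j‖ ^ 2 + ‖N s j‖ ^ 2 := by
        nlinarith [sq_nonneg (‖v s j‖ - ‖N s j‖)]
      have h4 : Real.exp (-s) ≤ 1 := Real.exp_le_one_iff.mpr (by linarith)
      have h5 := Real.exp_pos (-s)
      have h6 : Real.exp (-s) * ‖N s j‖ ^ 2 ≤ 1 * ‖N s j‖ ^ 2 := by gcongr
      have h7 : Real.exp (-s) * (-energy (c s) (v s) j - 2 * ε * inner ℝ (v s j) (N s j)) ≤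
          Real.exp (-s) * ‖N s j‖ ^ 2 := by gcongr; linarith
      linarith)
  have h1 := hanti h0 ht ht.1
  simp only [neg_zero, Real.exp_zero, one_mul, intervalIntegral.integral_same, sub_zero] at h1
  have h2 : ∫ r in (0 : ℝ)..t, ‖N r j‖ ^ 2 ≤ ∫ r in (0 : ℝ)..T, ‖N r j‖ ^ 2 :=
    intervalIntegral.integral_mono_interval le_rfl ht.1 ht.2
      (Eventually.of_forall fun r => sq_nonneg _) (hint T ⟨h0.2, le_rfl⟩)
  have h3 : Real.exp (-t) * energy (c t) (v t) j ≤
      energy (c 0) (v 0) j + ∫ r in (0 : ℝ)..T, ‖N r j‖ ^ 2 := by linarith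
  have h4 : 0 ≤ energy (c 0) (v 0) j + ∫ r in (0 : ℝ)..T, ‖N r j‖ ^ 2 :=
    add_nonneg (energy_nonneg _ _ _)
      (intervalIntegral.integral_nonneg h0.2 fun _ _ => sq_nonneg _)
  calc energy (c t) (v t) j = Real.exp t * (Real.exp (-t) * energy (c t) (v t) j) := by
        rw [← mul_assoc, ← Real.exp_add, add_neg_cancel, Real.exp_zero, one_mul]
    _ ≤ Real.exp t * (energy (c 0) (v 0) j + ∫ r in (0 : ℝ)..T, ‖N r j‖ ^ 2) := by gcongr
    _ ≤ _ := mul_le_mul_of_nonneg_right (Real.exp_le_exp.mpr ht.2) h4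

lemma IsModeSystem.tsum_N_le (h : IsModeSystem k ε T p c v N) (hk : 2 ≤ k) (hp : 1 ≤ p)
    (hS : Summable fun j : Fin n → ℤ => symb j ^ (-p)) {t : ℝ} (ht : t ∈ Set.Icc 0 T) :
    Summable (fun j => symb j ^ p * ‖N t j‖ ^ 2) ∧
      ∑' j, symb j ^ p * ‖N t j‖ ^ 2 ≤
        (constC₀ n p ^ 2 / 2) ^ (k - 1) * (normH p (c t) ^ 2) ^ k := by
  have := summable_and_tsum_le_of_convPow hp hS (f := fun j => ‖c t j‖) (x := fun j => ‖N t j‖)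
    (r := k - 1) (fun j => norm_nonneg _) (h.cont_c.memH ht) (fun j => norm_nonneg _) (fun j => by
      simp only [ofReal_norm]; exact h.enorm_N_le t ht j)
  rwa [← normH_sq p (c t), show k - 1 + 1 = k by omega] at this

/-- Gains the derivative missing from the hypotheses: `u ∈ H^p` already bounds the nonlinearity in
`H^p`, and the mode equation passes this on to the energy. The bound is uniform in time, as needed
to differentiate under the sum. -/
lemma IsModeSystem.exists_summable_energy_bound (h : IsModeSystem k ε T p c v N) (hε : |ε| = 1)
    (hT : 0 ≤ T) (hk : 2 ≤ k) (hp : 1 ≤ p)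
    (hS : Summable fun j : Fin n → ℤ => symb j ^ (-p))
    (h0 : Summable fun j => symb j ^ p * energy (c 0) (v 0) j) :
    ∃ Q : (Fin n → ℤ) → ℝ, (Summable fun j => symb j ^ p * Q j) ∧
      ∀ t ∈ Set.Icc 0 T, ∀ j, energy (c t) (v t) j ≤ Q j := by
  refine ⟨fun j => Real.exp T * (energy (c 0) (v 0) j + ∫ s in (0 : ℝ)..T, ‖N s j‖ ^ 2), ?_,
    fun t ht j => h.energy_le hε j ht⟩
  obtain ⟨R, hR⟩ := isCompact_Icc.exists_bound_of_continuousOn h.cont_c.continuousOn_normH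
  have hInt : Summable fun j => symb j ^ p * ∫ s in (0 : ℝ)..T, ‖N s j‖ ^ 2 := by
    refine summable_of_sum_le (c := T * ((constC₀ n p ^ 2 / 2) ^ (k - 1) * (R ^ 2) ^ k))
      (fun j => mul_nonneg (symb_rpow_pos p j).le
        (intervalIntegral.integral_nonneg hT fun _ _ => sq_nonneg _)) fun F => ?_
    have hii : ∀ j, IntervalIntegrable (fun s => symb j ^ p * ‖N s j‖ ^ 2) volume 0 T := fun j =>
      ContinuousOn.intervalIntegrable (by
        rw [Set.uIcc_of_le hT]; exact continuousOn_const.mul ((h.cont_N j).norm.pow 2))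
    simp_rw [← intervalIntegral.integral_const_mul]
    rw [← intervalIntegral.integral_finsetSum fun j _ => hii j]
    have hK : T * ((constC₀ n p ^ 2 / 2) ^ (k - 1) * (R ^ 2) ^ k) =
        ∫ _s in (0 : ℝ)..T, (constC₀ n p ^ 2 / 2) ^ (k - 1) * (R ^ 2) ^ k := by
      rw [intervalIntegral.integral_const, sub_zero, smul_eq_mul]
    rw [hK]
    refine intervalIntegral.integral_mono_on hT
      (by simpa only [Finset.sum_fn] using IntervalIntegrable.sum F fun j _ => hii j)
      intervalIntegrable_const fun s hs => ?_
    obtain ⟨h1, h2⟩ := h.tsum_N_le hk hp hS hs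
    refine (h1.sum_le_tsum F fun j _ => mul_nonneg (symb_rpow_pos p j).le (sq_nonneg _)).trans
      (h2.trans ?_)
    have h3 := hR s hs
    rw [Real.norm_of_nonneg (normH_nonneg _ _)] at h3
    have := normH_nonneg p (c s)
    gcongr
  refine ((h0.add hInt).mul_left (Real.exp T)).congr fun j => ?_
  ring

/-- Since `|c_j| ≤ √(Q j)` at all times, the convolution power of `√Q` dominates `N` uniformly in
time, and it is square summable by the algebra property. -/
lemma IsModeSystem.exists_summable_N_bound (h : IsModeSystem k ε T p c v N)
    (hp : 1 ≤ p) (hS : Summable fun j : Fin n → ℤ => symb j ^ (-p)) {Q : (Fin n → ℤ) → ℝ}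
    (hQ0 : ∀ j, 0 ≤ Q j) (hQ : Summable fun j => symb j ^ p * Q j)
    (hEQ : ∀ t ∈ Set.Icc 0 T, ∀ j, energy (c t) (v t) j ≤ Q j) :
    ∃ P : (Fin n → ℤ) → ℝ, (Summable fun j => symb j ^ p * P j ^ 2) ∧
      ∀ t ∈ Set.Icc 0 T, ∀ j, ‖N t j‖ ≤ P j := by
  set f : (Fin n → ℤ) → ℝ≥0∞ := fun a => ENNReal.ofReal √(Q a) with hf
  have hQs : Summable fun j => symb j ^ p * √(Q j) ^ 2 := by
    simpa only [Real.sq_sqrt (hQ0 _)] using hQ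
  have hfin : sqH p (convPow f (k - 1)) ≠ ∞ := by
    refine ne_top_of_le_ne_top ?_ (sqH_convPow_le hp f (k - 1))
    refine ENNReal.mul_ne_top (ENNReal.pow_ne_top (ENNReal.mul_ne_top ENNReal.ofReal_ne_top
      hS.tsum_ofReal_ne_top)) (ENNReal.pow_ne_top ?_)
    have : sqH p f = ∑' j, ENNReal.ofReal (symb j ^ p * √(Q j) ^ 2) := tsum_congr fun j => by
      rw [ENNReal.ofReal_mul (symb_rpow_pos p j).le, ENNReal.ofReal_pow (Real.sqrt_nonneg _)]
    rw [this]
    exact hQs.tsum_ofReal_ne_top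
  have hne : ∀ j, convPow f (k - 1) j ≠ ∞ := fun j hj => by
    have h1 := ENNReal.ne_top_of_tsum_ne_top hfin j
    rw [hj] at h1
    refine h1 (ENNReal.mul_eq_top.mpr (Or.inl ⟨?_, by simp⟩))
    simp [symb_rpow_pos]
  refine ⟨fun j => (convPow f (k - 1) j).toReal, ?_, fun t ht j => ?_⟩
  · exact (summable_and_tsum_le_of_convPow hp hS (fun j => Real.sqrt_nonneg _) hQs
      (fun j => ENNReal.toReal_nonneg) fun j => ENNReal.ofReal_toReal_le).1
  · rw [← toReal_enorm]
    refine ENNReal.toReal_mono (hne j) ((h.enorm_N_le t ht j).trans (convPow_mono (fun a => ?_) _ _))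
    rw [← ofReal_norm]
    exact ENNReal.ofReal_le_ofReal (Real.le_sqrt_of_sq_le
      ((sq_le_energy_left (c t) (v t) a).trans (hEQ t ht a)))

/-! ### The differential inequality for the Gevrey energy -/

/-- The Gevrey energy with weight `θ`. -/
def gevreyEnergy (p τ : ℝ) (θ : (Fin n → ℤ) → ℝ) (c v : (Fin n → ℤ) → ℂ) : ℝ :=
  ∑' j, symb j ^ p * Real.exp (2 * τ * θ j) * energy c v j

lemma gevreyEnergy_nonneg (p τ : ℝ) (θ : (Fin n → ℤ) → ℝ) (c v : (Fin n → ℤ) → ℂ) :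
    0 ≤ gevreyEnergy p τ θ c v :=
  tsum_nonneg fun j => mul_nonneg (mul_nonneg (symb_rpow_pos p j).le (Real.exp_pos _).le)
    (energy_nonneg _ _ _)

/-- The dissipation produced by a shrinking radius. -/
def gevreyDissipation (p τ : ℝ) (θ : (Fin n → ℤ) → ℝ) (c v : (Fin n → ℤ) → ℂ) : ℝ :=
  ∑' j, θ j * (symb j ^ p * Real.exp (2 * τ * θ j) * energy c v j)

lemma summable_gevreyEnergy {p τ M : ℝ} {θ : (Fin n → ℤ) → ℝ} (hτ : 0 ≤ τ) (hθM : ∀ j, θ j ≤ M)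
    {Q : (Fin n → ℤ) → ℝ} (hQ : Summable fun j => symb j ^ p * Q j) {c v : (Fin n → ℤ) → ℂ}
    (hEQ : ∀ j, energy c v j ≤ Q j) :
    Summable fun j => symb j ^ p * Real.exp (2 * τ * θ j) * energy c v j := by
  refine Summable.of_nonneg_of_le (fun j => ?_) (fun j => ?_)
    (hQ.mul_left (Real.exp (2 * τ * M)))
  · exact mul_nonneg (mul_nonneg (symb_rpow_pos p j).le (Real.exp_pos _).le) (energy_nonneg _ _ _)
  · have h1 := symb_rpow_pos p j
    have h2 := energy_nonneg c v j
    calc symb j ^ p * Real.exp (2 * τ * θ j) * energy c v j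
        ≤ symb j ^ p * Real.exp (2 * τ * M) * Q j := by
          gcongr
          · exact hθM j
          · exact hEQ j
      _ = _ := by ring

/-- Termwise differentiation, dominated through `Q` and `P` because `θ` is bounded. The derivative
of the exponential produces the dissipation; Cauchy–Schwarz and `nonlinear_estimate` bound the rest.
-/
lemma IsModeSystem.exists_hasDerivWithinAt_gevreyEnergy (h : IsModeSystem k ε T p c v N)
    (hε : |ε| = 1) (hT : 0 ≤ T) (hk : 2 ≤ k) (hp : 1 ≤ p)
    (hS : Summable fun j : Fin n → ℤ => symb j ^ (-p))
    (h0 : Summable fun j => symb j ^ p * energy (c 0) (v 0) j)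
    {θ : (Fin n → ℤ) → ℝ} {M : ℝ} (hθ : ∀ j, 0 ≤ θ j)
    (hθadd : ∀ a b, θ (a + b) ≤ θ a + θ b) (hθs : ∀ j, θ j ^ 2 ≤ symb j) (hθM : ∀ j, θ j ≤ M)
    {τ τ' : ℝ → ℝ} (hτ0 : ∀ t ∈ Set.Icc 0 T, 0 ≤ τ t)
    (hτ : ∀ t ∈ Set.Icc 0 T, HasDerivWithinAt τ (τ' t) (Set.Icc 0 T) t)
    (hτ' : ContinuousOn τ' (Set.Icc 0 T)) :
    ∃ G' : ℝ → ℝ, ∀ t ∈ Set.Icc 0 T,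
      HasDerivWithinAt (fun t => gevreyEnergy p (τ t) θ (c t) (v t)) (G' t) (Set.Icc 0 T) t ∧
      G' t ≤ 2 * τ' t * gevreyDissipation p (τ t) θ (c t) (v t) +
        2 * √(gevreyEnergy p (τ t) θ (c t) (v t)) *
          (constC₀ n p ^ (k - 1) / √2 * (Real.exp 1 ^ k * normH p (c t) ^ k +
          τ t ^ (k + 1) * gevreyDissipation p (τ t) θ (c t) (v t) *
            gevreyEnergy p (τ t) θ (c t) (v t) ^ ((k : ℝ) / 2 - 1))) := by
  obtain ⟨Q, hQ, hEQ⟩ := h.exists_summable_energy_bound hε hT hk hp hS h0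
  have hQ0 : ∀ j, 0 ≤ Q j := fun j =>
    (energy_nonneg _ _ _).trans (hEQ 0 ⟨le_rfl, hT⟩ j)
  obtain ⟨P, hP, hNP⟩ := h.exists_summable_N_bound hp hS hQ0 hQ hEQ
  obtain ⟨L, hL⟩ := isCompact_Icc.exists_bound_of_continuousOn hτ'
  obtain ⟨R, hR⟩ := isCompact_Icc.exists_bound_of_continuousOn
    (fun t ht => (hτ t ht).continuousWithinAt : ContinuousOn τ (Set.Icc 0 T))
  have hsum : ∀ t ∈ Set.Icc 0 T, Summable fun j =>
      symb j ^ p * Real.exp (2 * τ t * θ j) * energy (c t) (v t) j := fun t ht =>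
    summable_gevreyEnergy (hτ0 t ht) hθM hQ (hEQ t ht)
  have hM0 : 0 ≤ M := (hθ 0).trans (hθM 0)
  have hL0 : 0 ≤ L := (norm_nonneg _).trans (hL 0 ⟨le_rfl, hT⟩)
  let g' : (Fin n → ℤ) → ℝ → ℝ := fun j t =>
    symb j ^ p * (Real.exp (2 * τ t * θ j) * (2 * τ' t * θ j)) * energy (c t) (v t) j +
      symb j ^ p * Real.exp (2 * τ t * θ j) * (-(2 * ε * inner ℝ (v t j) (N t j)))
  have hg : ∀ j, ∀ t ∈ Set.Icc 0 T, HasDerivWithinAt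
      (fun t => symb j ^ p * Real.exp (2 * τ t * θ j) * energy (c t) (v t) j) (g' j t)
      (Set.Icc 0 T) t := fun j t ht =>
    (((((hτ t ht).const_mul 2).mul_const (θ j)).exp).const_mul (symb j ^ p)).mul
      (h.hasDerivWithinAt_energy j ht)
  let b : (Fin n → ℤ) → ℝ := fun j => Real.exp (2 * R * M) * (2 * L * M) * (symb j ^ p * Q j) +
    Real.exp (2 * R * M) * (symb j ^ p * Q j + symb j ^ p * P j ^ 2)
  have hb : Summable b := (hQ.mul_left _).add ((hQ.add hP).mul_left _)
  have hg'b : ∀ j, ∀ t ∈ Set.Icc 0 T, |g' j t| ≤ b j := fun j t ht => by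
    have e1 := symb_rpow_pos p j
    have e2 : Real.exp (2 * τ t * θ j) ≤ Real.exp (2 * R * M) := by
      have hle := (le_abs_self _).trans (hR t ht)
      have hR0 := (hτ0 t ht).trans hle
      have := hθ j
      have := hθM j
      gcongr
    have e3 : |2 * τ' t * θ j| ≤ 2 * L * M := by
      rw [abs_mul, abs_mul, abs_two, abs_of_nonneg (hθ j)]
      have := hL t ht
      rw [Real.norm_eq_abs] at this
      have := hθ j
      have := hθM j
      gcongr
    have e4 : |-(2 * ε * inner ℝ (v t j) (N t j))| ≤ Q j + P j ^ 2 := by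
      refine (IsModeSystem.abs_deriv_energy_le hε _ _).trans ?_
      have f1 := (sq_le_energy_right (c t) (v t) j).trans (hEQ t ht j)
      have f2 : ‖N t j‖ ^ 2 ≤ P j ^ 2 := by
        have := hNP t ht j
        gcongr
      nlinarith [sq_nonneg (‖v t j‖ - ‖N t j‖)]
    have e5 : |energy (c t) (v t) j| ≤ Q j := by
      rw [abs_of_nonneg (energy_nonneg _ _ _)]; exact hEQ t ht j
    have hQj := hQ0 j
    refine (abs_add_le _ _).trans ?_
    refine add_le_add ?_ ?_
    · rw [abs_mul, abs_mul, abs_mul, abs_of_pos e1, Real.abs_exp]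
      calc symb j ^ p * (Real.exp (2 * τ t * θ j) * |2 * τ' t * θ j|) * |energy (c t) (v t) j|
          ≤ symb j ^ p * (Real.exp (2 * R * M) * (2 * L * M)) * Q j := by gcongr
        _ = _ := by ring
    · rw [abs_mul, abs_mul, abs_of_pos e1, Real.abs_exp]
      calc symb j ^ p * Real.exp (2 * τ t * θ j) * |-(2 * ε * inner ℝ (v t j) (N t j))|
          ≤ symb j ^ p * Real.exp (2 * R * M) * (Q j + P j ^ 2) := by gcongr
        _ = _ := by ring
  refine ⟨fun t => ∑' j, g' j t, fun t ht =>
    ⟨hasDerivWithinAt_tsum_Icc hb hg hg'b hsum ht, ?_⟩⟩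
  obtain ⟨hNs, hNle⟩ := nonlinear_estimate hk hp hS (hτ0 t ht) hθ hθadd hθs hθM
    (h.cont_c.memH ht) (fun j => symb_mul_le_energy (c t) (v t) j) (hsum t ht) (h.enorm_N_le t ht)
  set g : (Fin n → ℤ) → ℝ := fun j => symb j ^ p * Real.exp (2 * τ t * θ j) * energy (c t) (v t) j
    with hgdef
  set y : (Fin n → ℤ) → ℝ := fun j => symb j ^ p * (Real.exp (τ t * θ j) * ‖N t j‖) ^ 2 with hydef
  have hg0 : ∀ j, 0 ≤ g j := fun j =>
    mul_nonneg (mul_nonneg (symb_rpow_pos p j).le (Real.exp_pos _).le) (energy_nonneg _ _ _)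
  have hy0 : ∀ j, 0 ≤ y j := fun j => mul_nonneg (symb_rpow_pos p j).le (sq_nonneg _)
  obtain ⟨hgy, hgyle⟩ := tsum_mul_le_sqrt_mul_sqrt (a := fun j => √(g j)) (b := fun j => √(y j))
    (fun j => Real.sqrt_nonneg _) (fun j => Real.sqrt_nonneg _)
    (by simpa only [Real.sq_sqrt (hg0 _)] using hsum t ht)
    (by simpa only [Real.sq_sqrt (hy0 _)] using hNs)
  simp only [Real.sq_sqrt (hg0 _), Real.sq_sqrt (hy0 _)] at hgyle
  have hX : Summable fun j => θ j * g j :=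
    Summable.of_nonneg_of_le (fun j => mul_nonneg (hθ j) (hg0 j))
      (fun j => mul_le_mul_of_nonneg_right (hθM j) (hg0 j)) ((hsum t ht).mul_left M)
  have hterm : ∀ j, g' j t ≤ 2 * τ' t * (θ j * g j) + 2 * (√(g j) * √(y j)) := fun j => by
    have e1 := symb_rpow_pos p j
    have e2 := Real.exp_pos (2 * τ t * θ j)
    have e3 : Real.exp (2 * τ t * θ j) = Real.exp (τ t * θ j) ^ 2 := by
      rw [← Real.exp_nat_mul]; congr 1; push_cast; ring
    have e4 : symb j ^ p * Real.exp (2 * τ t * θ j) * (‖v t j‖ * ‖N t j‖) ≤ √(g j) * √(y j) := by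
      rw [← Real.sqrt_mul (hg0 j)]
      refine Real.le_sqrt_of_sq_le ?_
      calc (symb j ^ p * Real.exp (2 * τ t * θ j) * (‖v t j‖ * ‖N t j‖)) ^ 2
          = symb j ^ p * Real.exp (2 * τ t * θ j) * ‖v t j‖ ^ 2 * y j := by
            simp only [hydef, e3]; ring
        _ ≤ g j * y j := by
            refine mul_le_mul_of_nonneg_right ?_ (hy0 j)
            exact mul_le_mul_of_nonneg_left (sq_le_energy_right _ _ _) (by positivity)
    have e5 := (abs_le.mp (IsModeSystem.abs_deriv_energy_le hε (v t j) (N t j))).2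
    have e6 : symb j ^ p * Real.exp (2 * τ t * θ j) * (-(2 * ε * inner ℝ (v t j) (N t j))) ≤
        symb j ^ p * Real.exp (2 * τ t * θ j) * (2 * (‖v t j‖ * ‖N t j‖)) :=
      mul_le_mul_of_nonneg_left e5 (by positivity)
    simp only [g', hgdef] at e4 ⊢
    linarith
  have hg's : Summable fun j => g' j t := Summable.of_norm_bounded hb fun j => hg'b j t ht
  calc ∑' j, g' j t ≤ ∑' j, (2 * τ' t * (θ j * g j) + 2 * (√(g j) * √(y j))) :=
        hg's.tsum_le_tsum hterm ((hX.mul_left _).add (hgy.mul_left _))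
    _ = 2 * τ' t * (∑' j, θ j * g j) + 2 * ∑' j, √(g j) * √(y j) := by
        rw [(hX.mul_left _).tsum_add (hgy.mul_left _), tsum_mul_left, tsum_mul_left]
    _ ≤ 2 * τ' t * (∑' j, θ j * g j) + 2 * (√(∑' j, g j) * √(∑' j, y j)) := by linarith
    _ ≤ _ := by
        refine add_le_add le_rfl ?_
        rw [← mul_assoc]
        exact mul_le_mul_of_nonneg_left hNle (by positivity)

end KleinGordon

end

noncomputable section

namespace KleinGordon

open scoped ENNReal

/-! ### The differential equation for the radius -/

lemma SolvesRadiusODE.continuousOn {k : ℕ} {T σ : ℝ} {h τ : ℝ → ℝ}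
    (hτ : SolvesRadiusODE k T σ h τ) : ContinuousOn τ (Set.Icc 0 T) :=
  fun t ht => (hτ.2 t ht).continuousWithinAt

/-- The equation is `τ' = -(τ^k h) τ` with bounded coefficient, so `τ` cannot reach zero, and by the
intermediate value theorem it keeps its initial sign. -/
lemma SolvesRadiusODE.pos {k : ℕ} {T σ : ℝ} {h τ : ℝ → ℝ} (hτ : SolvesRadiusODE k T σ h τ)
    (hσ : 0 < σ) (hh : ContinuousOn h (Set.Icc 0 T)) {t : ℝ} (ht : t ∈ Set.Icc 0 T) :
    0 < τ t := by
  have hc := hτ.continuousOn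
  obtain ⟨L, hL⟩ := isCompact_Icc.exists_bound_of_continuousOn ((hc.pow k).mul hh)
  -- Squaring `τ` makes the derivative nonnegative without knowing the sign of `τ`.
  have hd : ∀ s ∈ Set.Icc 0 T, HasDerivWithinAt (fun s => τ s ^ 2 * Real.exp (2 * L * s))
      (2 * τ s ^ 2 * Real.exp (2 * L * s) * (L - τ s ^ k * h s)) (Set.Icc 0 T) s := fun s hs => by
    have h1 := ((hτ.2 s hs).pow 2).mul
      ((((hasDerivAt_id s).const_mul (2 * L)).exp).hasDerivWithinAt (s := Set.Icc 0 T))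
    convert! h1 using 1
    simp only [id, Nat.cast_ofNat, Pi.pow_apply]
    ring
  have hmono := monotoneOn_of_hasDerivWithinAt_nonneg (convex_Icc 0 T)
    (fun s hs => (hd s hs).continuousWithinAt)
    (fun s hs => (hd s (interior_subset hs)).mono interior_subset) (fun s hs => by
      have := (le_abs_self _).trans (hL s (interior_subset hs))
      have h2 : 0 ≤ L - τ s ^ k * h s := sub_nonneg.mpr this
      positivity)
  have hne : ∀ s ∈ Set.Icc 0 T, τ s ≠ 0 := fun s hs h0 => by
    have h1 := hmono ⟨le_rfl, ht.1.trans ht.2⟩ hs hs.1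
    simp only [hτ.1, h0, mul_zero, Real.exp_zero] at h1
    nlinarith
  by_contra hneg
  have hivt : (0 : ℝ) ∈ τ '' Set.Icc 0 t :=
    intermediate_value_Icc' ht.1 (hc.mono (Set.Icc_subset_Icc_right ht.2))
      ⟨not_lt.mp hneg, by rw [hτ.1]; exact hσ.le⟩
  obtain ⟨s, hs, hs0⟩ := hivt
  exact hne s ⟨hs.1, hs.2.trans ht.2⟩ hs0

/-- The substitution `τ^(-k)` linearises the equation: its derivative is `k h`. -/
lemma SolvesRadiusODE.le_of_rate_le {k : ℕ} {T σ : ℝ} {h₁ h₂ τ₁ τ₂ : ℝ → ℝ} (hk : k ≠ 0)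
    (hσ : 0 < σ) (hτ₁ : SolvesRadiusODE k T σ h₁ τ₁) (hτ₂ : SolvesRadiusODE k T σ h₂ τ₂)
    (hc₁ : ContinuousOn h₁ (Set.Icc 0 T)) (hc₂ : ContinuousOn h₂ (Set.Icc 0 T))
    (hle : ∀ t ∈ Set.Icc 0 T, h₁ t ≤ h₂ t) {t : ℝ} (ht : t ∈ Set.Icc 0 T) : τ₂ t ≤ τ₁ t := by
  have hinv : ∀ {h τ : ℝ → ℝ}, SolvesRadiusODE k T σ h τ → ContinuousOn h (Set.Icc 0 T) →
      ∀ s ∈ Set.Icc 0 T,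
        HasDerivWithinAt (fun s => (τ s ^ k)⁻¹) (k * h s) (Set.Icc 0 T) s := by
    intro h τ hτ hh s hs
    have hpos := hτ.pos hσ hh hs
    have h1 := ((hτ.2 s hs).pow k).inv (pow_ne_zero k hpos.ne')
    convert! h1 using 1
    obtain ⟨r, rfl⟩ : ∃ r, k = r + 1 := ⟨k - 1, by omega⟩
    simp only [Nat.add_sub_cancel, Pi.pow_apply]
    field_simp
    ring
  have hd : ∀ s ∈ Set.Icc 0 T, HasDerivWithinAt (fun s => (τ₂ s ^ k)⁻¹ - (τ₁ s ^ k)⁻¹)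
      (k * h₂ s - k * h₁ s) (Set.Icc 0 T) s := fun s hs =>
    (hinv hτ₂ hc₂ s hs).sub (hinv hτ₁ hc₁ s hs)
  have hmono := monotoneOn_of_hasDerivWithinAt_nonneg (convex_Icc 0 T)
    (fun s hs => (hd s hs).continuousWithinAt)
    (fun s hs => (hd s (interior_subset hs)).mono interior_subset) (fun s hs => by
      have := hle s (interior_subset hs)
      rw [← mul_sub]
      exact mul_nonneg (Nat.cast_nonneg k) (sub_nonneg.mpr this))
  have h1 := hmono ⟨le_rfl, ht.1.trans ht.2⟩ ht ht.1
  simp only [hτ₁.1, hτ₂.1, sub_self, sub_nonneg] at h1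
  have hp₁ := hτ₁.pos hσ hc₁ ht
  have hp₂ := hτ₂.pos hσ hc₂ ht
  rw [inv_le_inv₀ (by positivity) (by positivity)] at h1
  exact le_of_pow_le_pow_left₀ hk hp₁.le h1

/-! ### Propagation of the Gevrey bound -/

variable {n k : ℕ} {ε T p : ℝ} {c v N : ℝ → (Fin n → ℤ) → ℂ}

/-- The bound for `C₀` times the Gevrey norm of the solution. -/
def sobolevBound (k : ℕ) (p Y : ℝ) (c : ℝ → (Fin n → ℤ) → ℂ) (t : ℝ) : ℝ :=
  constC₀ n p * Y + 1 / 2 * constC₀ n p ^ k * (Real.exp 1 * √2) ^ k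
    * ∫ s in (0 : ℝ)..t, normH p (c s) ^ k

lemma ContinuousInH.hasDerivWithinAt_sobolevBound (hc : ContinuousInH T p c) (k : ℕ) (Y : ℝ)
    {t : ℝ} (ht : t ∈ Set.Icc 0 T) :
    HasDerivWithinAt (sobolevBound k p Y c)
      (1 / 2 * constC₀ n p ^ k * (Real.exp 1 * √2) ^ k * normH p (c t) ^ k) (Set.Icc 0 T) t :=
  ((hasDerivWithinAt_integral_Icc (hc.continuousOn_normH.pow k) ht).const_mul _).const_add _

lemma le_sobolevBound (k : ℕ) (p Y : ℝ) (c : ℝ → (Fin n → ℤ) → ℂ) {t : ℝ} (ht : 0 ≤ t) :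
    constC₀ n p * Y ≤ sobolevBound k p Y c t := by
  refine le_add_of_nonneg_right (mul_nonneg ?_
    (intervalIntegral.integral_nonneg ht fun s _ => pow_nonneg (normH_nonneg _ _) _))
  have := constC₀_nonneg n p
  positivity

lemma constC₀_pos (hS : Summable fun j : Fin n → ℤ => symb j ^ (-p)) : 0 < constC₀ n p := by
  have h1 : 0 < ∑' j : Fin n → ℤ, symb j ^ (-p) :=
    hS.tsum_pos (fun j => (symb_rpow_pos _ j).le) 0 (symb_rpow_pos _ 0)
  unfold constC₀
  positivity

lemma hasDerivWithinAt_Ici_of_Icc {f : ℝ → ℝ} {f' t : ℝ} (ht : t ∈ Set.Ico 0 T)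
    (h : HasDerivWithinAt f f' (Set.Icc 0 T) t) : HasDerivWithinAt f f' (Set.Ici t) t :=
  h.mono_of_mem_nhdsWithin (mem_of_superset (Icc_mem_nhdsGE ht.2)
    (Set.Icc_subset_Icc_left ht.1))

/-- The strict inequality at a point where the energy `s²` touches the barrier, `C s = B ρ`. The
slack `1/√2` tolerates `ρ^(k-1) ≤ √2`, so the dissipation absorbs the term with `X`; what is left is
controlled by `B' < D`. -/
lemma two_mul_sqrt_mul_rate_lt {X s C τ E H B ρ B' D : ℝ} {k : ℕ} (hk : 2 ≤ k) (hX : 0 ≤ X)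
    (hs : 0 < s) (hC : 0 < C) (hτ : 0 ≤ τ) (hE : 0 ≤ E) (hH : 0 ≤ H) (hB : 0 < B)
    (hCs : C * s = B * ρ) (hρ : ρ ^ (k - 1) ≤ √2)
    (hB' : B' = 1 / 2 * C ^ k * (E * √2) ^ k * H ^ k) (hD : B' < D) :
    2 * (-τ ^ (k + 1) * B ^ (k - 1)) * X + 2 * √(s ^ 2) *
      (C ^ (k - 1) / √2 * (E ^ k * H ^ k + τ ^ (k + 1) * X * (s ^ 2) ^ ((k : ℝ) / 2 - 1))) <
      2 * s * (D / C) := by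
  obtain ⟨r, rfl⟩ : ∃ r, k = r + 2 := ⟨k - 2, by omega⟩
  have h2 : 0 < √2 := Real.sqrt_pos.mpr two_pos
  have h2' : √2 * √2 = 2 := Real.mul_self_sqrt two_pos.le
  have hpow : (s ^ 2) ^ (((r + 2 : ℕ) : ℝ) / 2 - 1) = s ^ r := by
    rw [← Real.rpow_natCast s 2, ← Real.rpow_mul hs.le, ← Real.rpow_natCast s r]
    congr 1
    push_cast
    ring
  rw [Real.sqrt_sq hs.le, hpow]
  have e0 : r + 2 - 1 = r + 1 := by omega
  rw [e0] at hρ ⊢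
  have hXτ : 0 ≤ τ ^ (r + 2 + 1) * X := by positivity
  have hdiss : (C * s) ^ (r + 1) / √2 ≤ B ^ (r + 1) := by
    rw [hCs, mul_pow, div_le_iff₀ h2]
    exact mul_le_mul_of_nonneg_left hρ (by positivity)
  have hgrow : C ^ (r + 1) / √2 * (E ^ (r + 2) * H ^ (r + 2)) ≤ B' / C := by
    rw [le_div_iff₀ hC, hB', mul_pow E]
    have h3 : 1 / √2 ≤ 1 / 2 * √2 ^ (r + 2) := by
      rw [pow_succ, div_le_iff₀ h2]
      have : 1 ≤ √2 ^ (r + 1) := one_le_pow₀ (by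
        rw [Real.one_le_sqrt]; norm_num)
      nlinarith
    calc C ^ (r + 1) / √2 * (E ^ (r + 2) * H ^ (r + 2)) * C
        = (1 / √2) * (C ^ (r + 2) * E ^ (r + 2) * H ^ (r + 2)) := by ring
      _ ≤ (1 / 2 * √2 ^ (r + 2)) * (C ^ (r + 2) * E ^ (r + 2) * H ^ (r + 2)) := by gcongr
      _ = _ := by ring
  have hlt : B' / C < D / C := div_lt_div_of_pos_right hD hC
  have hsplit : 2 * (-τ ^ (r + 2 + 1) * B ^ (r + 1)) * X + 2 * s *
      (C ^ (r + 1) / √2 * (E ^ (r + 2) * H ^ (r + 2) + τ ^ (r + 2 + 1) * X * s ^ r)) =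
      2 * (τ ^ (r + 2 + 1) * X) * ((C * s) ^ (r + 1) / √2 - B ^ (r + 1)) +
      2 * s * (C ^ (r + 1) / √2 * (E ^ (r + 2) * H ^ (r + 2))) := by ring
  rw [hsplit]
  have t1 : 2 * (τ ^ (r + 2 + 1) * X) * ((C * s) ^ (r + 1) / √2 - B ^ (r + 1)) ≤ 0 :=
    mul_nonpos_of_nonneg_of_nonpos (by positivity) (by linarith)
  have t2 : 2 * s * (C ^ (r + 1) / √2 * (E ^ (r + 2) * H ^ (r + 2))) < 2 * s * (D / C) :=
    mul_lt_mul_of_pos_left (hgrow.trans_lt hlt) (by positivity)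
  linarith

/-- The estimate closes at a contact point with the bound, but only with a weak inequality. The
bound is therefore perturbed to a strict barrier and the perturbation is sent to zero. The
assumption `0 < Y` keeps the barrier positive. -/
lemma IsModeSystem.gevreyEnergy_le (h : IsModeSystem k ε T p c v N)
    (hε : |ε| = 1) (hT : 0 ≤ T) (hk : 2 ≤ k) (hp : 1 ≤ p)
    (hS : Summable fun j : Fin n → ℤ => symb j ^ (-p))
    (h0 : Summable fun j => symb j ^ p * energy (c 0) (v 0) j)
    {θ : (Fin n → ℤ) → ℝ} {M : ℝ} (hθ : ∀ j, 0 ≤ θ j)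
    (hθadd : ∀ a b, θ (a + b) ≤ θ a + θ b) (hθs : ∀ j, θ j ^ 2 ≤ symb j) (hθM : ∀ j, θ j ≤ M)
    {σ Y : ℝ} (hσ : 0 < σ) (hY : 0 < Y) {τ : ℝ → ℝ}
    (hτ : SolvesRadiusODE k T σ (fun t => sobolevBound k p Y c t ^ (k - 1)) τ)
    (hinit : gevreyEnergy p σ θ (c 0) (v 0) ≤ Y ^ 2) {t : ℝ} (ht : t ∈ Set.Icc 0 T) :
    gevreyEnergy p (τ t) θ (c t) (v t) ≤ (sobolevBound k p Y c t / constC₀ n p) ^ 2 := by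
  have hC := constC₀_pos hS
  set C := constC₀ n p with hCdef
  set B := sobolevBound k p Y c with hBdef
  have hBd := fun s hs => h.cont_c.hasDerivWithinAt_sobolevBound k Y (t := s) hs
  rw [← hBdef] at hBd
  have hBc : ContinuousOn B (Set.Icc 0 T) := fun s hs => (hBd s hs).continuousWithinAt
  have hBpos : ∀ s ∈ Set.Icc 0 T, 0 < B s := fun s hs =>
    (mul_pos hC hY).trans_le (le_sobolevBound k p Y c hs.1)
  have hratec : ContinuousOn (fun t => B t ^ (k - 1)) (Set.Icc 0 T) := hBc.pow _
  have hτ0 : ∀ s ∈ Set.Icc 0 T, 0 ≤ τ s := fun s hs => (hτ.pos hσ hratec hs).le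
  obtain ⟨G', hG'⟩ := h.exists_hasDerivWithinAt_gevreyEnergy hε hT hk hp hS h0 hθ hθadd hθs hθM
    hτ0 hτ.2 ((hτ.continuousOn.pow (k + 1)).neg.mul hratec)
  -- The increasing factor `1 + δ (1 + t)` adds `B δ > 0` to the derivative of the barrier; for
  -- small `δ` its power stays below `√2`.
  have key : ∀ δ : ℝ, 0 < δ → (1 + δ * (1 + T)) ^ (k - 1) ≤ √2 →
      gevreyEnergy p (τ t) θ (c t) (v t) ≤ (B t * (1 + δ * (1 + t)) / C) ^ 2 := by
    intro δ hδ hδT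
    have hbd : ∀ s ∈ Set.Icc 0 T, HasDerivWithinAt (fun s => (B s * (1 + δ * (1 + s)) / C) ^ 2)
        (2 * (B s * (1 + δ * (1 + s)) / C) *
          (((1 / 2 * C ^ k * (Real.exp 1 * √2) ^ k * normH p (c s) ^ k) * (1 + δ * (1 + s)) +
            B s * δ) / C)) (Set.Icc 0 T) s := fun s hs => by
      have h1 : HasDerivWithinAt (fun s => 1 + δ * (1 + s)) (δ * 1) (Set.Icc 0 T) s :=
        ((((hasDerivAt_id s).const_add 1).const_mul δ).const_add 1).hasDerivWithinAt
      have h2 := (((hBd s hs).mul h1).div_const C).pow 2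
      convert! h2 using 1
      simp only [Pi.mul_apply, Nat.cast_ofNat]
      ring
    refine image_le_of_deriv_right_lt_deriv_boundary' (a := 0) (b := T)
      (f := fun t => gevreyEnergy p (τ t) θ (c t) (v t))
      (fun s hs => (hG' s hs).1.continuousWithinAt)
      (fun s hs => hasDerivWithinAt_Ici_of_Icc hs (hG' s ⟨hs.1, hs.2.le⟩).1) ?_
      (fun s hs => (hbd s hs).continuousWithinAt)
      (fun s hs => hasDerivWithinAt_Ici_of_Icc hs (hbd s ⟨hs.1, hs.2.le⟩)) ?_ ht
    · rw [hτ.1]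
      refine hinit.trans (pow_le_pow_left₀ hY.le ?_ 2)
      rw [le_div_iff₀ hC, mul_comm]
      have h1 := le_sobolevBound k p Y c (t := 0) le_rfl
      exact h1.trans (le_mul_of_one_le_right ((mul_pos hC hY).le.trans h1) (by linarith))
    · intro s hs htouch
      have hs' : s ∈ Set.Icc 0 T := ⟨hs.1, hs.2.le⟩
      have hρ1 : 1 ≤ 1 + δ * (1 + s) := by
        have := mul_nonneg hδ.le (add_nonneg zero_le_one hs.1)
        linarith
      refine (hG' s hs').2.trans_lt ?_
      rw [htouch]
      have hBs := hBpos s hs'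
      have hH := normH_nonneg p (c s)
      refine two_mul_sqrt_mul_rate_lt hk (tsum_nonneg fun j => mul_nonneg (hθ j) ?_)
        (by positivity) hC (hτ0 s hs') (Real.exp_pos 1).le hH hBs ?_ (ρ := 1 + δ * (1 + s)) ?_ rfl ?_
      · exact mul_nonneg (mul_nonneg (symb_rpow_pos p j).le (Real.exp_pos _).le)
          (energy_nonneg _ _ _)
      · rw [mul_div_cancel₀ _ hC.ne']
      · refine (pow_le_pow_left₀ (by linarith) ?_ _).trans hδT
        have := hs.2.le
        gcongr
      · have h1 : 0 ≤ 1 / 2 * C ^ k * (Real.exp 1 * √2) ^ k * normH p (c s) ^ k := by positivity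
        have h2 := le_mul_of_one_le_right h1 hρ1
        have h3 := mul_pos hBs hδ
        linarith
  have hlim : Tendsto (fun δ : ℝ => (B t * (1 + δ * (1 + t)) / C) ^ 2) (𝓝[>] 0)
      (𝓝 ((B t / C) ^ 2)) := by
    have : Continuous fun δ : ℝ => (B t * (1 + δ * (1 + t)) / C) ^ 2 := by fun_prop
    have h1 := this.tendsto 0
    simp only [zero_mul, add_zero, mul_one] at h1
    exact h1.mono_left nhdsWithin_le_nhds
  refine ge_of_tendsto hlim ?_
  have hev : ∀ᶠ δ : ℝ in 𝓝[>] 0, (1 + δ * (1 + T)) ^ (k - 1) < √2 := by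
    have : Continuous fun δ : ℝ => (1 + δ * (1 + T)) ^ (k - 1) := by fun_prop
    have h1 := this.tendsto 0
    simp only [zero_mul, add_zero, one_pow] at h1
    exact (h1.mono_left nhdsWithin_le_nhds).eventually_lt_const
      (by rw [Real.lt_sqrt] <;> norm_num)
  filter_upwards [hev, self_mem_nhdsWithin] with δ h1 h2
  exact key δ h2 h1.le

/-- The case of zero data, where the barrier degenerates. With zero weight and radius, `‖u‖_{H^p} ≤
√G`; boundedness of the norm then turns the nonlinear bound into `G' ≤ L G`, and Gronwall applies.
-/
lemma IsModeSystem.energy_eq_zero (h : IsModeSystem k ε T p c v N)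
    (hε : |ε| = 1) (hT : 0 ≤ T) (hk : 2 ≤ k) (hp : 1 ≤ p)
    (hS : Summable fun j : Fin n → ℤ => symb j ^ (-p))
    (h0 : ∀ j, energy (c 0) (v 0) j = 0) {t : ℝ} (ht : t ∈ Set.Icc 0 T) (j : Fin n → ℤ) :
    energy (c t) (v t) j = 0 := by
  have hs0 : Summable fun j => symb j ^ p * energy (c 0) (v 0) j := by
    simp only [h0, mul_zero]; exact summable_zero
  obtain ⟨Q, hQ, hEQ⟩ := h.exists_summable_energy_bound hε hT hk hp hS hs0
  have hsum : ∀ s ∈ Set.Icc 0 T, Summable fun j => symb j ^ p * energy (c s) (v s) j :=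
    fun s hs => by
      simpa using summable_gevreyEnergy (τ := 0) (M := 0) (θ := fun _ => 0) le_rfl
        (fun _ => le_rfl) hQ (hEQ s hs)
  obtain ⟨G', hG'⟩ := h.exists_hasDerivWithinAt_gevreyEnergy hε hT hk hp hS hs0
    (θ := fun _ => 0) (M := 0) (τ := fun _ => 0) (τ' := fun _ => 0) (fun _ => le_rfl)
    (fun _ _ => by simp) (fun j => by simpa using (symb_pos j).le) (fun _ => le_rfl)
    (fun _ _ => le_rfl) (fun s _ => hasDerivWithinAt_const s _ _) continuousOn_const
  simp only [gevreyDissipation, mul_zero, zero_mul, tsum_zero, zero_add, add_zero] at hG'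
  set G : ℝ → ℝ := fun s => gevreyEnergy p 0 (fun _ => 0) (c s) (v s) with hG
  have hGeq : ∀ s, G s = ∑' j, symb j ^ p * energy (c s) (v s) j := fun s => by
    simp [hG, gevreyEnergy]
  have hG0 : ∀ s, 0 ≤ G s := fun s => gevreyEnergy_nonneg _ _ _ _ _
  obtain ⟨R, hR⟩ := isCompact_Icc.exists_bound_of_continuousOn h.cont_c.continuousOn_normH
  have hCn := constC₀_nonneg n p
  set L := 2 * (constC₀ n p ^ (k - 1) / √2 * (Real.exp 1 ^ k * R ^ (k - 1))) with hL
  have hGL : ∀ s ∈ Set.Icc 0 T, G' s ≤ L * G s := fun s hs => by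
    have hH0 := normH_nonneg p (c s)
    have hHR : normH p (c s) ≤ R := (le_abs_self _).trans (hR s hs)
    have hR0 : 0 ≤ R := hH0.trans hHR
    have hHG : normH p (c s) ≤ √(G s) := by
      refine Real.le_sqrt_of_sq_le ?_
      rw [normH_sq, hGeq]
      exact (h.cont_c.memH hs).tsum_le_tsum (fun j => mul_le_mul_of_nonneg_left
        (sq_le_energy_left _ _ _) (symb_rpow_pos p j).le) (hsum s hs)
    have hHk : normH p (c s) ^ k ≤ R ^ (k - 1) * √(G s) := by
      conv_lhs => rw [show k = k - 1 + 1 by omega, pow_succ]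
      gcongr
    calc G' s ≤ 2 * √(G s) * (constC₀ n p ^ (k - 1) / √2 *
          (Real.exp 1 ^ k * normH p (c s) ^ k)) := (hG' s hs).2
      _ ≤ 2 * √(G s) * (constC₀ n p ^ (k - 1) / √2 *
          (Real.exp 1 ^ k * (R ^ (k - 1) * √(G s)))) := by gcongr
      _ = L * (√(G s) * √(G s)) := by rw [hL]; ring
      _ = L * G s := by rw [Real.mul_self_sqrt (hG0 s)]
  have hd : ∀ s ∈ Set.Icc 0 T, HasDerivWithinAt (fun s => Real.exp (-(L * s)) * G s)
      (Real.exp (-(L * s)) * (-(L * 1)) * G s + Real.exp (-(L * s)) * G' s) (Set.Icc 0 T) s :=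
    fun s hs =>
      ((((hasDerivAt_id s).const_mul L).neg.exp).hasDerivWithinAt).mul (hG' s hs).1
  have hanti := antitoneOn_of_hasDerivWithinAt_nonpos (convex_Icc 0 T)
    (fun s hs => (hd s hs).continuousWithinAt)
    (fun s hs => (hd s (interior_subset hs)).mono interior_subset) (fun s hs => by
      have h1 := hGL s (interior_subset hs)
      have h2 := mul_le_mul_of_nonneg_left h1 (Real.exp_pos (-(L * s))).le
      linarith)
  have h1 := hanti ⟨le_rfl, hT⟩ ht ht.1
  have hGz : G 0 = 0 := by simp [hGeq, h0]
  simp only [hGz, mul_zero] at h1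
  have hGt : G t = 0 := le_antisymm (by
    by_contra hpos
    exact absurd h1 (not_le.mpr (mul_pos (Real.exp_pos _) (not_le.mp hpos)))) (hG0 t)
  rw [hGeq] at hGt
  have h2 := (hasSum_zero_iff_of_nonneg fun j => mul_nonneg (symb_rpow_pos p j).le
    (energy_nonneg (c t) (v t) j)).mp ((hsum t ht).hasSum_iff.mpr hGt)
  exact (mul_eq_zero.mp (congrFun h2 j)).resolve_left (symb_rpow_pos p j).ne'

/-- Finite partial sums are bounded through the truncated weight, with a bound that does not see the
truncation. -/
lemma IsModeSystem.summable_gevrey (h : IsModeSystem k ε T p c v N) (m : ℕ)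
    (hε : |ε| = 1) (hT : 0 ≤ T) (hk : 2 ≤ k) (hp : 1 ≤ p)
    (hS : Summable fun j : Fin n → ℤ => symb j ^ (-p)) {σ Y : ℝ} (hσ : 0 < σ) (hY : 0 ≤ Y)
    (h0 : HasSum (fun j => symb j ^ p * Real.exp (2 * σ * absFirst m j) * energy (c 0) (v 0) j)
      (Y ^ 2)) {τ : ℝ → ℝ}
    (hτ : SolvesRadiusODE k T σ (fun t => sobolevBound k p Y c t ^ (k - 1)) τ)
    {t : ℝ} (ht : t ∈ Set.Icc 0 T) :
    Summable fun j => symb j ^ p * Real.exp (2 * τ t * absFirst m j) * energy (c t) (v t) j := by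
  have hnn : ∀ (s : ℝ) (θ : (Fin n → ℤ) → ℝ) (c v : (Fin n → ℤ) → ℂ) (j : Fin n → ℤ),
      0 ≤ symb j ^ p * Real.exp (2 * s * θ j) * energy c v j := fun s θ c v j =>
    mul_nonneg (mul_nonneg (symb_rpow_pos p j).le (Real.exp_pos _).le) (energy_nonneg _ _ _)
  rcases hY.eq_or_lt with hY0 | hYpos
  · rw [← hY0, zero_pow two_ne_zero] at h0
    have h1 := (hasSum_zero_iff_of_nonneg (hnn σ (absFirst m) (c 0) (v 0))).mp h0
    have h2 : ∀ j, energy (c 0) (v 0) j = 0 := fun j =>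
      (mul_eq_zero.mp (congrFun h1 j)).resolve_left
        (mul_pos (symb_rpow_pos p j) (Real.exp_pos _)).ne'
    simp only [h.energy_eq_zero hε hT hk hp hS h2 ht, mul_zero]
    exact summable_zero
  · have hexp : ∀ j, symb j ^ p * energy (c 0) (v 0) j ≤
        symb j ^ p * Real.exp (2 * σ * absFirst m j) * energy (c 0) (v 0) j := fun j => by
      have := absFirst_nonneg m j
      exact mul_le_mul_of_nonneg_right (le_mul_of_one_le_right (symb_rpow_pos p j).le
        (Real.one_le_exp (by positivity))) (energy_nonneg _ _ _)
    have hs0 : Summable fun j => symb j ^ p * energy (c 0) (v 0) j :=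
      Summable.of_nonneg_of_le (fun j => mul_nonneg (symb_rpow_pos p j).le (energy_nonneg _ _ _))
        hexp h0.summable
    have hBc : ContinuousOn (fun t => sobolevBound k p Y c t ^ (k - 1)) (Set.Icc 0 T) :=
      ContinuousOn.pow (fun s hs =>
        (h.cont_c.hasDerivWithinAt_sobolevBound k Y hs).continuousWithinAt) _
    have hτt := (hτ.pos hσ hBc ht).le
    refine summable_of_sum_le (c := (sobolevBound k p Y c t / constC₀ n p) ^ 2)
      (hnn (τ t) (absFirst m) (c t) (v t)) fun F => ?_
    -- Any level above `|j'|` for all `j ∈ F` would do; on `F` the truncation is then inactive.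
    set M : ℝ := ∑ j ∈ F, absFirst m j with hM
    have hM0 : 0 ≤ M := Finset.sum_nonneg fun j _ => absFirst_nonneg m j
    have hcut : ∀ j : Fin n → ℤ, cutWeight m M j ≤ absFirst m j := fun j => min_le_left _ _
    have hcutF : ∀ j ∈ F, cutWeight m M j = absFirst m j := fun j hj =>
      min_eq_left (Finset.single_le_sum (fun j _ => absFirst_nonneg m j) hj)
    have hcutM : ∀ j : Fin n → ℤ, cutWeight m M j ≤ M := fun j => min_le_right _ _
    have hinitle : ∀ j, symb j ^ p * Real.exp (2 * σ * cutWeight m M j) * energy (c 0) (v 0) j ≤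
        symb j ^ p * Real.exp (2 * σ * absFirst m j) * energy (c 0) (v 0) j := fun j => by
      have h1 := symb_rpow_pos p j
      have h2 := energy_nonneg (c 0) (v 0) j
      have h3 := hcut j
      gcongr
    have hinit : gevreyEnergy p σ (cutWeight m M) (c 0) (v 0) ≤ Y ^ 2 := by
      rw [← h0.tsum_eq]
      exact (Summable.of_nonneg_of_le (hnn σ _ _ _) hinitle h0.summable).tsum_le_tsum hinitle
        h0.summable
    have hmain := h.gevreyEnergy_le hε hT hk hp hS hs0 (cutWeight_nonneg m hM0)
      (cutWeight_add_le m hM0) (fun j => (pow_le_pow_left₀ (cutWeight_nonneg m hM0 j) (hcut j)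
        2).trans (absFirst_sq_le m j)) hcutM hσ hYpos hτ hinit ht
    obtain ⟨Q, hQ, hEQ⟩ := h.exists_summable_energy_bound hε hT hk hp hS hs0
    have hsum := summable_gevreyEnergy hτt hcutM hQ (hEQ t ht)
    calc ∑ j ∈ F, symb j ^ p * Real.exp (2 * τ t * absFirst m j) * energy (c t) (v t) j
        = ∑ j ∈ F, symb j ^ p * Real.exp (2 * τ t * cutWeight m M j) * energy (c t) (v t) j :=
          Finset.sum_congr rfl fun j hj => by rw [hcutF j hj]
      _ ≤ gevreyEnergy p (τ t) (cutWeight m M) (c t) (v t) :=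
          hsum.sum_le_tsum F fun j _ => hnn (τ t) _ _ _ j
      _ ≤ _ := hmain

end KleinGordon

end

noncomputable section

namespace KleinGordon

/-! ### Solutions of the Klein–Gordon equation -/

variable {n m k : ℕ} {ε T p σ : ℝ} {u₀ u₁ : L2T n} {u v : ℝ → L2T n}

lemma IsSolution.isModeSystem (h : IsSolution k ε T p u₀ u₁ u v) (hε : ε ≠ 0) (hk : 1 ≤ k)
    (hS : Summable fun j : Fin n → ℤ => symb j ^ (-p)) :
    IsModeSystem k ε T p (fun t => coeff (u t)) (fun t => coeff (v t))
      (fun t => powCoeff k (u t)) := by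
  obtain ⟨w, hwc, hvw, hweak⟩ := h.weak_eq
  have hw : ∀ t ∈ Set.Icc 0 T, ∀ j,
      w t j = -(symb j * coeff (u t) j) - ε * powCoeff k (u t) j := fun t ht j =>
    eq_of_weak_equation (hweak t ht) j
  refine ⟨fun j t ht => ?_, fun j t ht => ?_, fun j => ?_, fun t ht j => ?_, h.cont_u⟩
  · exact h.deriv_u.hasDerivWithinAt_apply
      (fun s hs => (h.cont_u.memH hs).mono (by linarith)) (fun s hs => h.cont_v.memH hs) j ht
  · rw [← hw t ht j]
    exact hvw.hasDerivWithinAt_apply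
      (fun s hs => (h.cont_v.memH hs).mono (by linarith)) (fun s hs => hwc.memH hs) j ht
  -- Continuity of the coefficients of `u^k` is read off from the equation itself, solved for the
  -- nonlinearity.
  · have h1 : ContinuousOn
        (fun t => -(ε : ℂ)⁻¹ * (w t j + symb j * coeff (u t) j)) (Set.Icc 0 T) :=
      continuousOn_const.mul ((hwc.continuousOn_apply j).add
        (continuousOn_const.mul (h.cont_u.continuousOn_apply j)))
    refine h1.congr fun t ht => ?_
    have hε' : (ε : ℂ) ≠ 0 := Complex.ofReal_ne_zero.mpr hε
    simp only [hw t ht j]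
    field_simp
    ring
  · have h1 := enorm_mFourierCoeff_pow_le (wienerNorm_le hS (h.cont_u.memH ht)).1 (k - 1) j
    rwa [show k - 1 + 1 = k by omega] at h1

lemma phi₀_eq_sqrt_energy (u₀ u₁ : L2T n) (j : Fin n → ℤ) :
    phi₀ u₀ u₁ j = √(energy (coeff u₀) (coeff u₁) j) := rfl

lemma hasSum_initY (hu₀ : u₀ ∈ gevreyDomain n m (p + 1) σ) (hu₁ : u₁ ∈ gevreyDomain n m p σ) :
    HasSum (fun j => symb j ^ p * Real.exp (2 * σ * absFirst m j) *
      energy (coeff u₀) (coeff u₁) j) (initY m p σ u₀ u₁ ^ 2) := by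
  have hnn : ∀ (q : ℝ) (f : L2T n) (j : Fin n → ℤ),
      0 ≤ ‖coeff f j‖ ^ 2 * symb j ^ q * Real.exp (2 * σ * absFirst m j) := fun q f j =>
    mul_nonneg (mul_nonneg (sq_nonneg _) (symb_rpow_pos q j).le) (Real.exp_pos _).le
  rw [initY, Real.sq_sqrt (by positivity), gevreyNorm, gevreyNorm,
    Real.sq_sqrt (tsum_nonneg (hnn p u₁)), Real.sq_sqrt (tsum_nonneg (hnn (p + 1) u₀))]
  refine (hu₁.hasSum.add hu₀.hasSum).congr_fun fun j => ?_
  rw [energy, Real.rpow_add_one (symb_pos j).ne']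
  ring

lemma mem_gevreyDomain_of_summable {f g : L2T n} {τ : ℝ}
    (h : Summable fun j => symb j ^ p * Real.exp (2 * τ * absFirst m j) *
      energy (coeff f) (coeff g) j) :
    f ∈ gevreyDomain n m (p + 1) τ ∧ g ∈ gevreyDomain n m p τ := by
  have hw : ∀ j : Fin n → ℤ, 0 ≤ symb j ^ p * Real.exp (2 * τ * absFirst m j) := fun j =>
    mul_nonneg (symb_rpow_pos p j).le (Real.exp_pos _).le
  constructor
  · refine Summable.of_nonneg_of_le (fun j => mul_nonneg (mul_nonneg (sq_nonneg _)
      (symb_rpow_pos _ j).le) (Real.exp_pos _).le) (fun j => ?_) h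
    rw [Real.rpow_add_one (symb_pos j).ne']
    refine le_trans (le_of_eq ?_)
      (mul_le_mul_of_nonneg_left (symb_mul_le_energy (coeff f) (coeff g) j) (hw j))
    ring
  · refine Summable.of_nonneg_of_le (fun j => mul_nonneg (mul_nonneg (sq_nonneg _)
      (symb_rpow_pos _ j).le) (Real.exp_pos _).le) (fun j => ?_) h
    refine le_trans (le_of_eq ?_)
      (mul_le_mul_of_nonneg_left (sq_le_energy_right (coeff f) (coeff g) j) (hw j))
    ring

/-! ### Comparison of the two rates. -/

lemma initSmallY_le (hS : Summable fun j : Fin n → ℤ => symb j ^ (-p))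
    (hu₀ : u₀ ∈ gevreyDomain n m (p + 1) σ) (hu₁ : u₁ ∈ gevreyDomain n m p σ) :
    (Summable fun j => Real.exp (σ * absFirst m j) * phi₀ u₀ u₁ j) ∧
      initSmallY m σ u₀ u₁ ≤ √(∑' j : Fin n → ℤ, symb j ^ (-p)) * initY m p σ u₀ u₁ := by
  have h1 : ∀ j : Fin n → ℤ, (symb j ^ (-p / 2)) ^ 2 = symb j ^ (-p) := fun j => by
    rw [← Real.rpow_natCast, ← Real.rpow_mul (symb_pos j).le]; congr 1; push_cast; ring
  have h2 : ∀ j : Fin n → ℤ, symb j ^ (-p / 2) * symb j ^ (p / 2) = 1 := fun j => by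
    rw [← Real.rpow_add (symb_pos j)]
    ring_nf
    simp
  have h3 : ∀ j : Fin n → ℤ, (symb j ^ (p / 2) * (Real.exp (σ * absFirst m j) *
      phi₀ u₀ u₁ j)) ^ 2 = symb j ^ p * Real.exp (2 * σ * absFirst m j) *
        energy (coeff u₀) (coeff u₁) j := fun j => by
    have e1 : (symb j ^ (p / 2)) ^ 2 = symb j ^ p := by
      rw [← Real.rpow_natCast, ← Real.rpow_mul (symb_pos j).le]; congr 1; push_cast; ring
    have e2 : Real.exp (σ * absFirst m j) ^ 2 = Real.exp (2 * σ * absFirst m j) := by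
      rw [← Real.exp_nat_mul]; congr 1; push_cast; ring
    rw [mul_pow, mul_pow, e1, e2, phi₀_eq_sqrt_energy, Real.sq_sqrt (energy_nonneg _ _ _)]
    ring
  have h4 := hasSum_initY hu₀ hu₁
  have key := tsum_mul_le_sqrt_mul_sqrt (a := fun j : Fin n → ℤ => symb j ^ (-p / 2))
    (b := fun j => symb j ^ (p / 2) * (Real.exp (σ * absFirst m j) * phi₀ u₀ u₁ j))
    (fun j => (symb_rpow_pos _ j).le)
    (fun j => mul_nonneg (symb_rpow_pos _ j).le (mul_nonneg (Real.exp_pos _).le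
      (Real.sqrt_nonneg _))) (by simpa only [h1] using hS)
    (by simpa only [h3] using h4.summable)
  simp only [← mul_assoc _ (symb _ ^ (p / 2)), h1, h2, h3, one_mul, h4.tsum_eq] at key
  rwa [Real.sqrt_sq (show 0 ≤ initY m p σ u₀ u₁ from Real.sqrt_nonneg _)] at key

lemma two_mul_sqrt_le_constC₀ (n : ℕ) (hp : 1 ≤ p) :
    2 * √(∑' j : Fin n → ℤ, symb j ^ (-p)) * √2 ≤ constC₀ n p := by
  rw [constC₀, Real.sqrt_mul two_pos.le]
  have h1 : (2 : ℝ) ≤ 2 ^ p := by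
    simpa using Real.rpow_le_rpow_of_exponent_le one_le_two hp
  calc 2 * √(∑' j : Fin n → ℤ, symb j ^ (-p)) * √2
      = 2 * (√2 * √(∑' j : Fin n → ℤ, symb j ^ (-p))) := by ring
    _ ≤ _ := by gcongr

lemma two_mul_initSmallY_le (hS : Summable fun j : Fin n → ℤ => symb j ^ (-p)) (hp : 1 ≤ p)
    (hu₀ : u₀ ∈ gevreyDomain n m (p + 1) σ) (hu₁ : u₁ ∈ gevreyDomain n m p σ) :
    2 * initSmallY m σ u₀ u₁ ≤ constC₀ n p * initY m p σ u₀ u₁ := by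
  have h1 := (initSmallY_le hS hu₀ hu₁).2
  have h2 := two_mul_sqrt_le_constC₀ n hp
  have h3 : 1 ≤ √2 := by rw [Real.one_le_sqrt]; norm_num
  have h4 : 2 * √(∑' j : Fin n → ℤ, symb j ^ (-p)) ≤ constC₀ n p :=
    (le_mul_of_one_le_right (by positivity) h3).trans h2
  calc 2 * initSmallY m σ u₀ u₁
      ≤ 2 * (√(∑' j : Fin n → ℤ, symb j ^ (-p)) * initY m p σ u₀ u₁) := by gcongr
    _ = (2 * √(∑' j : Fin n → ℤ, symb j ^ (-p))) * initY m p σ u₀ u₁ := by ring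
    _ ≤ _ := mul_le_mul_of_nonneg_right h4 (Real.sqrt_nonneg _)

/-- The factor `(√2)^k` on the right makes the bound hold with a spare `2^k`, which compensates the
`1/2`. -/
lemma two_pow_mul_wienerNorm_pow_le (hS : Summable fun j : Fin n → ℤ => symb j ^ (-p))
    (hp : 1 ≤ p) (hk : 1 ≤ k) {c : (Fin n → ℤ) → ℂ} (hc : MemH p c) :
    2 ^ k * Real.exp 1 ^ k * wienerNorm c ^ k ≤
      1 / 2 * constC₀ n p ^ k * (Real.exp 1 * √2) ^ k * normH p c ^ k := by
  set s := √(∑' j : Fin n → ℤ, symb j ^ (-p)) with hs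
  have hH := normH_nonneg p c
  have hW0 : 0 ≤ wienerNorm c := tsum_nonneg fun _ => norm_nonneg _
  have h1 : (2 * wienerNorm c) ^ k ≤ (2 * (s * normH p c)) ^ k := by
    have := (wienerNorm_le hS hc).2
    gcongr
  have h2 : (2 * (s * normH p c)) ^ k ≤ 1 / 2 * (constC₀ n p * √2 * normH p c) ^ k := by
    have h3 : 2 * (2 * (s * normH p c)) ≤ constC₀ n p * √2 * normH p c := by
      have h4 := mul_le_mul_of_nonneg_right (two_mul_sqrt_le_constC₀ n hp) (Real.sqrt_nonneg 2)
      rw [mul_assoc, Real.mul_self_sqrt two_pos.le, ← hs] at h4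
      calc 2 * (2 * (s * normH p c)) = 2 * s * 2 * normH p c := by ring
        _ ≤ _ := mul_le_mul_of_nonneg_right h4 hH
    have h5 := pow_le_pow_left₀ (by positivity) h3 k
    rw [mul_pow] at h5
    have h6 : (2 : ℝ) ≤ 2 ^ k := by
      simpa using pow_le_pow_right₀ one_le_two hk
    have h7 : 2 * (2 * (s * normH p c)) ^ k ≤ 2 ^ k * (2 * (s * normH p c)) ^ k := by gcongr
    linarith
  calc 2 ^ k * Real.exp 1 ^ k * wienerNorm c ^ k
      = Real.exp 1 ^ k * (2 * wienerNorm c) ^ k := by rw [mul_pow 2]; ring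
    _ ≤ Real.exp 1 ^ k * (1 / 2 * (constC₀ n p * √2 * normH p c) ^ k) := by
        gcongr; exact h1.trans h2
    _ = _ := by rw [mul_pow, mul_pow, mul_pow]; ring

lemma intervalIntegrable_of_continuousOn_Icc {f : ℝ → ℝ} (hf : ContinuousOn f (Set.Icc 0 T))
    {t : ℝ} (ht : t ∈ Set.Icc 0 T) : IntervalIntegrable f volume 0 t :=
  (hf.mono (by rw [Set.uIcc_of_le ht.1]; exact Set.Icc_subset_Icc_right ht.2)).intervalIntegrable

end KleinGordon

end

/-! ### The main theorem. -/

theorem proposition3 (n m k : ℕ) (hm : 1 ≤ m) (hmn : m ≤ n) (hk : 2 ≤ k)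
    (ε : ℝ) (hε : ε = 1 ∨ ε = -1)
    (p σ T : ℝ) (hp : (n : ℝ) / 2 < p) (hp1 : 1 ≤ p) (hσ : 0 < σ) (hT : 0 < T)
    (u₀ u₁ : KleinGordon.L2T n) (u v : ℝ → KleinGordon.L2T n)
    (hu₀ : u₀ ∈ KleinGordon.gevreyDomain n m (p + 1) σ)
    (hu₁ : u₁ ∈ KleinGordon.gevreyDomain n m p σ)
    (hsol : KleinGordon.IsSolution k ε T p u₀ u₁ u v) :
    -- persistence of the Gevrey-Sobolev regularity
    (∀ τ : ℝ → ℝ, KleinGordon.SolvesRadiusODE k T σ (KleinGordon.h₂ m k p σ u₀ u₁ u) τ →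
      ∀ t ∈ Set.Icc 0 T,
        u t ∈ KleinGordon.gevreyDomain n m (p + 1) (τ t) ∧
        v t ∈ KleinGordon.gevreyDomain n m p (τ t)) ∧
    -- the quantities that enter `h₁` are finite
    KleinGordon.MemGevreyL1 m σ (KleinGordon.opA (KleinGordon.coeff u₀)) ∧
    KleinGordon.MemGevreyL1 m σ (KleinGordon.coeff u₁) ∧
    (Summable fun j => Real.exp (σ * KleinGordon.absFirst m j) * KleinGordon.phi₀ u₀ u₁ j) ∧
    (∀ t ∈ Set.Icc 0 T, Summable fun j => ‖KleinGordon.coeff (u t) j‖) ∧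
    IntervalIntegrable (fun s => KleinGordon.wienerNorm (KleinGordon.coeff (u s)) ^ k)
      MeasureTheory.volume 0 T ∧
    -- comparison of the two rates and of the two bounds on the radius of analyticity
    (∀ t ∈ Set.Icc 0 T,
      KleinGordon.h₁ m k σ u₀ u₁ u t ≤ KleinGordon.h₂ m k p σ u₀ u₁ u t) ∧
    (∀ τ₁ τ₂ : ℝ → ℝ,
      KleinGordon.SolvesRadiusODE k T σ (KleinGordon.h₁ m k σ u₀ u₁ u) τ₁ →
      KleinGordon.SolvesRadiusODE k T σ (KleinGordon.h₂ m k p σ u₀ u₁ u) τ₂ →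
      ∀ t ∈ Set.Icc 0 T, τ₂ t ≤ τ₁ t) := by
  open KleinGordon in
  have hε1 : |ε| = 1 := by rcases hε with rfl | rfl <;> simp
  have hε0 : ε ≠ 0 := by rcases hε with rfl | rfl <;> simp
  have hS : Summable fun j : Fin n → ℤ => symb j ^ (-p) := summable_symb_rpow (hm.trans hmn) hp
  have hsys := hsol.isModeSystem hε0 (by omega) hS
  have hinit : HasSum (fun j => symb j ^ p * Real.exp (2 * σ * absFirst m j) *
      energy (coeff (u 0)) (coeff (v 0)) j) (initY m p σ u₀ u₁ ^ 2) := by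
    rw [hsol.init_u, hsol.init_v]
    exact hasSum_initY hu₀ hu₁
  obtain ⟨hphi, -⟩ := initSmallY_le hS hu₀ hu₁
  have hWc : ContinuousOn (fun s => wienerNorm (coeff (u s)) ^ k) (Set.Icc 0 T) :=
    (hsol.cont_u.continuousOn_wienerNorm hS).pow k
  have hHc : ContinuousOn (fun s => normH p (coeff (u s)) ^ k) (Set.Icc 0 T) :=
    hsol.cont_u.continuousOn_normH.pow k
  have hc₁ : ContinuousOn (h₁ m k σ u₀ u₁ u) (Set.Icc 0 T) := ContinuousOn.pow
    (fun t ht => (((hasDerivWithinAt_integral_Icc hWc ht).const_mul _).const_add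
      _).continuousWithinAt) _
  have hc₂ : ContinuousOn (h₂ m k p σ u₀ u₁ u) (Set.Icc 0 T) := ContinuousOn.pow
    (fun t ht => (((hasDerivWithinAt_integral_Icc hHc ht).const_mul _).const_add
      _).continuousWithinAt) _
  have hrate : ∀ t ∈ Set.Icc 0 T, h₁ m k σ u₀ u₁ u t ≤ h₂ m k p σ u₀ u₁ u t := fun t ht => by
    have hy0 : 0 ≤ initSmallY m σ u₀ u₁ :=
      tsum_nonneg fun j => mul_nonneg (Real.exp_pos _).le (Real.sqrt_nonneg _)
    have hI0 : 0 ≤ ∫ s in (0 : ℝ)..t, wienerNorm (coeff (u s)) ^ k :=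
      intervalIntegral.integral_nonneg ht.1 fun s _ =>
        pow_nonneg (tsum_nonneg fun _ => norm_nonneg _) k
    refine pow_le_pow_left₀ (by positivity)
      (add_le_add (two_mul_initSmallY_le hS hp1 hu₀ hu₁) ?_) _
    rw [← intervalIntegral.integral_const_mul, ← intervalIntegral.integral_const_mul]
    refine intervalIntegral.integral_mono_on ht.1
      ((intervalIntegrable_of_continuousOn_Icc hWc ht).const_mul _)
      ((intervalIntegrable_of_continuousOn_Icc hHc ht).const_mul _) fun s hs => ?_
    exact two_pow_mul_wienerNorm_pow_le hS hp1 (by omega)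
      (hsol.cont_u.memH ⟨hs.1, hs.2.trans ht.2⟩)
  refine ⟨fun τ hτ t ht => ?_, ?_, ?_, hphi, fun t ht => (wienerNorm_le hS
    (hsol.cont_u.memH ht)).1, intervalIntegrable_of_continuousOn_Icc hWc ⟨hT.le, le_rfl⟩, hrate,
    fun τ₁ τ₂ hτ₁ hτ₂ t ht => hτ₁.le_of_rate_le (by omega) hσ hτ₂ hc₁ hc₂ hrate ht⟩
  · exact mem_gevreyDomain_of_summable (hsys.summable_gevrey m hε1 hT.le hk hp1 hS hσ
      (Real.sqrt_nonneg _) hinit hτ ht)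
  · refine Summable.of_nonneg_of_le (fun j => by positivity) (fun j => ?_) hphi
    refine mul_le_mul_of_nonneg_left (Real.le_sqrt_of_sq_le ?_) (Real.exp_pos _).le
    rw [opA, norm_mul, mul_pow, Complex.norm_real, Real.norm_eq_abs, sq_abs,
      Real.sq_sqrt (symb_pos j).le]
    exact symb_mul_le_energy _ (coeff u₁) j
  · refine Summable.of_nonneg_of_le (fun j => by positivity) (fun j => ?_) hphi
    exact mul_le_mul_of_nonneg_left
      (Real.le_sqrt_of_sq_le (sq_le_energy_right (coeff u₀) _ j)) (Real.exp_pos _).le
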